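/- Let $\mathbb{H}$ be the quaternions, $\mathbb{B}=\{q\in\mathbb{H}:|q|<1\}$, $\mathrm{Sp}(1)=\{u\in\mathbb{H}:|u|=1\}$ and $$\mathrm{Sp}(1,1)=\{A\in M_2(\mathbb{H}) : A^*I_{1,1}A=I_{1,1}\},\qquad I_{1,1}=\begin{pmatrix}1&0\\0&-1\end{pmatrix},$$ the latter two with their usual Lie group structures. For functions $f(q)=\sum_{n\ge 0} q^na_n$ and $g(q)=\sum_{n\ge 0} q^nb_n$ given by power series converging on $\mathbb{B}$ (that is, slice regular functions), put $$(f*g)(q)=\sum_{n\ge0} q^n\sum_{k=0}^n a_kb_{n-k},\qquad f^c(q)=\sum_{n\ge0} q^n\overline{a_n},\qquad f^s=f*f^c,\qquad f^{-*}=\frac{1}{f^s}f^c,$$ the last one off the zeros of $f^s$. For $A=\begin{pmatrix}a&c\\b&d\end{pmatrix}\in\mathrm{Sp}(1,1)$ let $\mathcal{F}_A$ be the regular Möbius transformation $$\mathcal{F}_A(q)=(qc+d)^{-*}*(qa+b),\qquad q\in\mathbb{B},$$ and let $\mathcal{M}(\mathbb{B})=\{\mathcal{F}_A : A\in\mathrm{Sp}(1,1)\}$.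 Then every $\mathcal{F}_A$ maps $\mathbb{B}$ into $\mathbb{B}$. There is one and only one structure of smooth $7$-dimensional manifold on $\mathcal{M}(\mathbb{B})$ for which $A\,\mathrm{Sp}(1)I_2\mapsto\mathcal{F}_{A^{-1}}$ is a (well-defined) diffeomorphism $\mathrm{Sp}(1,1)/\mathrm{Sp}(1)I_2\to\mathcal{M}(\mathbb{B})$, where $\mathrm{Sp}(1,1)/\mathrm{Sp}(1)I_2$ has the quotient topology and a smooth manifold structure making the quotient map a submersion. With this structure on $\mathcal{M}(\mathbb{B})$, the map $$\pi:\mathrm{Sp}(1,1)\to\mathcal{M}(\mathbb{B}),\qquad A\mapsto\mathcal{F}_{A^{-1}},$$ is a principal fiber bundle with structure group $\mathrm{Sp}(1)$ acting on $\mathrm{Sp}(1,1)$ by the right translations $(A,u)\mapsto A\,(uI_2)$. That is: $\pi$ is a surjective smooth map whose differential at every point is surjective; the action is smooth, free and proper, and its orbits are precisely the fibers of $\pi$; and every point of $\mathcal{M}(\mathbb{B})$ has an open neighborhood $U$ with a diffeomorphism $\varphi_U:U\times\mathrm{Sp}(1)\to\pi^{-1}(U)$ such that $\pi(\varphi_U(x,u))=x$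 and $\varphi_U(x,uv)=\varphi_U(x,u)\,(vI_2)$ for all $x\in U$ and $u,v\in\mathrm{Sp}(1)$. -/

import Mathlib

open scoped Manifold ContDiff Quaternion Matrix

noncomputable section

namespace QuatMoebius

/-! ### The groups `Sp(1)` and `Sp(1,1)` -/

/-- The unit ball of the quaternions. -/
abbrev UnitBall : Type := Metric.ball (0 : ℍ[ℝ]) 1

/-- `Sp(1)`, the group of unit quaternions, i.e. the unit sphere of `ℍ` with quaternionic
multiplication and with the usual manifold structure of the 3-sphere. -/
abbrev Sp1 : Type := Metric.sphere (0 : ℍ[ℝ]) 1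

instance finrankQuaternion : Fact (Module.finrank ℝ ℍ[ℝ] = 3 + 1) :=
  ⟨Quaternion.finrank_eq_four⟩

/-- The matrix `I_{1,1}`. -/
def signatureMatrix : Matrix (Fin 2) (Fin 2) ℍ[ℝ] := !![1, 0; 0, -1]

/-- `Sp(1,1)`, the quaternionic matrices with `A^* I_{1,1} A = I_{1,1}`. It carries the topology
induced from the space of matrices. -/
def Sp11 : Type :=
  {A : Matrix (Fin 2) (Fin 2) ℍ[ℝ] // Aᴴ * signatureMatrix * A = signatureMatrix}

instance : TopologicalSpace Sp11 :=
  inferInstanceAs (TopologicalSpace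
    {A : Matrix (Fin 2) (Fin 2) ℍ[ℝ] // Aᴴ * signatureMatrix * A = signatureMatrix})

theorem signatureMatrix_mul_self : signatureMatrix * signatureMatrix = 1 := by
  ext i j : 1
  fin_cases i <;> fin_cases j <;> simp [signatureMatrix, Matrix.mul_apply, Fin.sum_univ_two]

theorem signatureMatrix_conjTranspose : signatureMatrixᴴ = signatureMatrix := by
  ext i j : 1
  fin_cases i <;> fin_cases j <;> simp [signatureMatrix]

theorem Sp11.inv_mul_aux (A : Sp11) :
    (signatureMatrix * A.1ᴴ * signatureMatrix) * A.1 = 1 := by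
  rw [Matrix.mul_assoc, Matrix.mul_assoc, ← Matrix.mul_assoc (A.1ᴴ), A.2,
    signatureMatrix_mul_self]

theorem Sp11.mul_inv_aux (A : Sp11) :
    A.1 * (signatureMatrix * A.1ᴴ * signatureMatrix) = 1 :=
  mul_eq_one_comm.mp A.inv_mul_aux

theorem Sp11.mul_signature_conjTranspose (A : Sp11) :
    A.1 * signatureMatrix * A.1ᴴ = signatureMatrix := by
  have h := congrArg (· * signatureMatrix) A.mul_inv_aux
  simpa only [Matrix.mul_assoc, signatureMatrix_mul_self, Matrix.mul_one, Matrix.one_mul] using h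

instance : Group Sp11 where
  mul A B := ⟨A.1 * B.1, by
    rw [Matrix.conjTranspose_mul]
    calc B.1ᴴ * A.1ᴴ * signatureMatrix * (A.1 * B.1)
        = B.1ᴴ * (A.1ᴴ * signatureMatrix * A.1) * B.1 := by simp only [Matrix.mul_assoc]
      _ = signatureMatrix := by rw [A.2, B.2]⟩
  one := ⟨1, by simp⟩
  inv A := ⟨signatureMatrix * A.1ᴴ * signatureMatrix, by
    simp only [Matrix.conjTranspose_mul, Matrix.conjTranspose_conjTranspose,
      signatureMatrix_conjTranspose]
    calc signatureMatrix * (A.1 * signatureMatrix) * signatureMatrix *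
          (signatureMatrix * A.1ᴴ * signatureMatrix)
        = signatureMatrix * (A.1 * signatureMatrix * (signatureMatrix * signatureMatrix)
            * A.1ᴴ) * signatureMatrix := by simp only [Matrix.mul_assoc]
      _ = signatureMatrix := by
        rw [signatureMatrix_mul_self, Matrix.mul_one, A.mul_signature_conjTranspose,
          signatureMatrix_mul_self, Matrix.one_mul]⟩
  mul_assoc A B C := Subtype.ext (Matrix.mul_assoc _ _ _)
  one_mul A := Subtype.ext (Matrix.one_mul _)
  mul_one A := Subtype.ext (Matrix.mul_one _)
  inv_mul_cancel A := Subtype.ext A.inv_mul_aux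

theorem Sp11.coe_mul (A B : Sp11) : (A * B).1 = A.1 * B.1 := rfl

theorem Sp11.coe_one : (1 : Sp11).1 = 1 := rfl

theorem Sp11.coe_inv (A : Sp11) : (A⁻¹).1 = signatureMatrix * A.1ᴴ * signatureMatrix := rfl

/-- The entries of `A` satisfy `|a|² - |b|² = 1`, `|d|² - |c|² = 1`, `a̅ c = b̅ d`, where
`A = (a c; b d)`. -/
theorem mem_Sp11_iff (A : Matrix (Fin 2) (Fin 2) ℍ[ℝ]) :
    Aᴴ * signatureMatrix * A = signatureMatrix ↔
      ‖A 0 0‖ ^ 2 = 1 + ‖A 1 0‖ ^ 2 ∧ ‖A 1 1‖ ^ 2 = 1 + ‖A 0 1‖ ^ 2 ∧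
        star (A 0 0) * A 0 1 = star (A 1 0) * A 1 1 := by
  have key : ∀ x y : ℍ[ℝ], (star x * x - star y * y = ((‖x‖ ^ 2 - ‖y‖ ^ 2 : ℝ) : ℍ[ℝ])) := by
    intro x y
    rw [Quaternion.star_mul_self, Quaternion.star_mul_self, Quaternion.normSq_eq_norm_mul_self,
      Quaternion.normSq_eq_norm_mul_self, pow_two, pow_two]
    push_cast
    rfl
  constructor
  · intro h
    have h00 := congrFun (congrFun h 0) 0
    have h11 := congrFun (congrFun h 1) 1
    have h01 := congrFun (congrFun h 0) 1
    simp [signatureMatrix, Matrix.mul_apply, Fin.sum_univ_two, ← sub_eq_add_neg] at h00 h11 h01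
    rw [key _ _] at h00
    have h11' : star (A 0 1) * A 0 1 - star (A 1 1) * A 1 1 = -1 := by simpa using h11
    rw [key _ _] at h11'
    have e0 : ‖A 0 0‖ ^ 2 - ‖A 1 0‖ ^ 2 = 1 :=
      Quaternion.coe_injective (by simpa using h00)
    have e1 : ‖A 0 1‖ ^ 2 - ‖A 1 1‖ ^ 2 = -1 :=
      Quaternion.coe_injective (by simpa using h11')
    refine ⟨by linarith, by linarith, sub_eq_zero.mp h01⟩
  · rintro ⟨h0, h1, h2⟩
    have h2' : star (A 0 1) * A 0 0 = star (A 1 1) * A 1 0 := by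
      have := congrArg star h2
      simpa [star_mul] using this
    have e0 := key (A 0 0) (A 1 0)
    have e1 := key (A 0 1) (A 1 1)
    rw [show ‖A 0 0‖ ^ 2 - ‖A 1 0‖ ^ 2 = 1 by linarith] at e0
    rw [show ‖A 0 1‖ ^ 2 - ‖A 1 1‖ ^ 2 = -1 by linarith] at e1
    ext i j : 1
    fin_cases i <;> fin_cases j <;>
      simp [signatureMatrix, Matrix.mul_apply, Fin.sum_univ_two, ← sub_eq_add_neg]
    · simpa using e0
    · exact sub_eq_zero.mpr h2
    · exact sub_eq_zero.mpr h2'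
    · simpa using e1

/-! ### The manifold structure of `Sp(1,1)`

`Sp(1,1)` is a closed submanifold of the space of matrices. The matrix with entries
`a = s u`, `c = u b̅ v`, `d = s v`, where `s = √(1 + |b|²)`, runs through `Sp(1,1)` exactly once
as `(b, u, v)` runs through `ℍ × Sp(1) × Sp(1)`; the charts are those of this product. The results
below show that this is the structure of an embedded submanifold of the space of matrices, and that
`Sp(1,1)` is a Lie group with it. -/

/-- The parameters `(b, u, v)`. -/
abbrev Sp11Param : Type := ℍ[ℝ] × Sp1 × Sp1

/-- The space on which the charts of `Sp(1,1)` take their values. -/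
abbrev Sp11Model : Type :=
  ModelProd ℍ[ℝ] (ModelProd (EuclideanSpace ℝ (Fin 3)) (EuclideanSpace ℝ (Fin 3)))

/-- The (boundaryless) model of `Sp(1,1)`. -/
abbrev sp11ModelWithCorners :
    ModelWithCorners ℝ (ℍ[ℝ] × EuclideanSpace ℝ (Fin 3) × EuclideanSpace ℝ (Fin 3)) Sp11Model :=
  𝓘(ℝ, ℍ[ℝ]).prod ((𝓡 3).prod (𝓡 3))

theorem norm_Sp1 (u : Sp1) : ‖(u : ℍ[ℝ])‖ = 1 := by simp

/-- The matrix with parameters `(b, u, v)`. -/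
def sp11OfParam (x : Sp11Param) : Sp11 :=
  ⟨!![√(1 + ‖x.1‖ ^ 2) • (x.2.1 : ℍ[ℝ]), x.2.1 * star x.1 * x.2.2;
      x.1, √(1 + ‖x.1‖ ^ 2) • (x.2.2 : ℍ[ℝ])], by
    have hs : √(1 + ‖x.1‖ ^ 2) ^ 2 = 1 + ‖x.1‖ ^ 2 := Real.sq_sqrt (by positivity)
    rw [mem_Sp11_iff]
    refine ⟨?_, ?_, ?_⟩
    · simp [norm_smul, hs]
    · simp [norm_smul, hs]
    · have h : star (x.2.1 : ℍ[ℝ]) * x.2.1 = 1 := by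
        rw [Quaternion.star_mul_self, Quaternion.normSq_eq_norm_mul_self, norm_Sp1]; simp
      simp only [Matrix.of_apply, Matrix.cons_val', Matrix.cons_val_zero, Matrix.cons_val_one,
        Matrix.cons_val_fin_one, Quaternion.star_smul, smul_mul_assoc, mul_smul_comm]
      rw [← mul_assoc, ← mul_assoc, h, one_mul]⟩

theorem Sp11.entries (A : Sp11) :
    ‖A.1 0 0‖ ^ 2 = 1 + ‖A.1 1 0‖ ^ 2 ∧ ‖A.1 1 1‖ ^ 2 = 1 + ‖A.1 0 1‖ ^ 2 ∧
      star (A.1 0 0) * A.1 0 1 = star (A.1 1 0) * A.1 1 1 := (mem_Sp11_iff A.1).mp A.2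

theorem Sp11.a_ne_zero (A : Sp11) : A.1 0 0 ≠ 0 := fun h => by
  have := A.entries.1
  rw [h, norm_zero] at this
  nlinarith [sq_nonneg ‖A.1 1 0‖]

theorem Sp11.d_ne_zero (A : Sp11) : A.1 1 1 ≠ 0 := fun h => by
  have := A.entries.2.1
  rw [h, norm_zero] at this
  nlinarith [sq_nonneg ‖A.1 0 1‖]

theorem Sp11.norm_a (A : Sp11) : ‖A.1 0 0‖ = √(1 + ‖A.1 1 0‖ ^ 2) := by
  rw [← A.entries.1, Real.sqrt_sq (norm_nonneg _)]

theorem Sp11.norm_d (A : Sp11) : ‖A.1 1 1‖ = √(1 + ‖A.1 1 0‖ ^ 2) := by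
  obtain ⟨h0, h1, h2⟩ := A.entries
  have h3 : ‖A.1 0 0‖ ^ 2 * ‖A.1 0 1‖ ^ 2 = ‖A.1 1 0‖ ^ 2 * ‖A.1 1 1‖ ^ 2 := by
    have := congrArg norm h2
    rw [norm_mul, norm_mul, norm_star, norm_star] at this
    rw [← mul_pow, ← mul_pow, this]
  have h4 : ‖A.1 1 1‖ ^ 2 = 1 + ‖A.1 1 0‖ ^ 2 := by nlinarith
  rw [← h4, Real.sqrt_sq (norm_nonneg _)]

/-- The parameters `(b, a / |a|, d / |d|)` of a matrix in `Sp(1,1)`. -/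
def sp11ToParam (A : Sp11) : Sp11Param :=
  (A.1 1 0,
    ⟨‖A.1 0 0‖⁻¹ • A.1 0 0, by
      rw [mem_sphere_zero_iff_norm, norm_smul, norm_inv, norm_norm]
      exact inv_mul_cancel₀ (norm_ne_zero_iff.mpr A.a_ne_zero)⟩,
    ⟨‖A.1 1 1‖⁻¹ • A.1 1 1, by
      rw [mem_sphere_zero_iff_norm, norm_smul, norm_inv, norm_norm]
      exact inv_mul_cancel₀ (norm_ne_zero_iff.mpr A.d_ne_zero)⟩)

theorem sp11OfParam_toParam (A : Sp11) : sp11OfParam (sp11ToParam A) = A := by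
  have ha : ‖A.1 0 0‖ ≠ 0 := norm_ne_zero_iff.mpr A.a_ne_zero
  have hd : ‖A.1 1 1‖ ≠ 0 := norm_ne_zero_iff.mpr A.d_ne_zero
  have had : ‖A.1 1 1‖ = ‖A.1 0 0‖ := by rw [A.norm_a, A.norm_d]
  have hc : A.1 0 0 * star (A.1 1 0) * A.1 1 1 = (‖A.1 0 0‖ ^ 2) • A.1 0 1 := by
    rw [mul_assoc, ← A.entries.2.2, ← mul_assoc, Quaternion.self_mul_star,
      Quaternion.normSq_eq_norm_mul_self, ← pow_two, Quaternion.coe_mul_eq_smul]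
  apply Subtype.ext
  ext i j : 1
  fin_cases i <;> fin_cases j
  · simp [sp11OfParam, sp11ToParam, ← A.norm_a, smul_smul, ha]
  · simp only [sp11OfParam, sp11ToParam, Fin.zero_eta, Fin.mk_one, Matrix.of_apply,
      Matrix.cons_val', Matrix.cons_val_zero, Matrix.cons_val_one, Matrix.cons_val_fin_one,
      smul_mul_assoc, mul_smul_comm, hc, smul_smul, had]
    field_simp
    simp
  · simp [sp11OfParam, sp11ToParam]
  · simp [sp11OfParam, sp11ToParam, ← A.norm_d, smul_smul, hd]

theorem sp11ToParam_ofParam (x : Sp11Param) : sp11ToParam (sp11OfParam x) = x := by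
  have hs : 0 < √(1 + ‖x.1‖ ^ 2) := Real.sqrt_pos.mpr (by positivity)
  refine Prod.ext ?_ (Prod.ext (Subtype.ext ?_) (Subtype.ext ?_))
  · simp [sp11OfParam, sp11ToParam]
  · simp [sp11OfParam, sp11ToParam, norm_smul, smul_smul, abs_of_pos hs, hs.ne']
  · simp [sp11OfParam, sp11ToParam, norm_smul, smul_smul, abs_of_pos hs, hs.ne']

theorem Sp11.continuous_entry (i j : Fin 2) : Continuous fun A : Sp11 => A.1 i j :=
  (continuous_subtype_val (p := fun A : Matrix (Fin 2) (Fin 2) ℍ[ℝ] =>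
    Aᴴ * signatureMatrix * A = signatureMatrix)).matrix_elem i j

/-- `Sp(1,1)` is homeomorphic to `ℍ × Sp(1) × Sp(1)`. -/
def sp11Homeomorph : Sp11 ≃ₜ Sp11Param where
  toFun := sp11ToParam
  invFun := sp11OfParam
  left_inv := sp11OfParam_toParam
  right_inv := sp11ToParam_ofParam
  continuous_toFun := by
    refine (Sp11.continuous_entry 1 0).prodMk (.prodMk (.subtype_mk ?_ _) (.subtype_mk ?_ _))
    · exact ((Sp11.continuous_entry 0 0).norm.inv₀ fun A => norm_ne_zero_iff.mpr A.a_ne_zero).smul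
        (Sp11.continuous_entry 0 0)
    · exact ((Sp11.continuous_entry 1 1).norm.inv₀ fun A => norm_ne_zero_iff.mpr A.d_ne_zero).smul
        (Sp11.continuous_entry 1 1)
  continuous_invFun := by
    refine Continuous.subtype_mk (continuous_matrix fun i j => ?_) _
    fin_cases i <;> fin_cases j <;> simp <;> fun_prop

instance : ChartedSpace Sp11Model Sp11 where
  atlas := {e | ∃ f ∈ atlas Sp11Model Sp11Param, e = sp11Homeomorph.toOpenPartialHomeomorph ≫ₕ f}
  chartAt A := sp11Homeomorph.toOpenPartialHomeomorph ≫ₕ chartAt Sp11Model (sp11Homeomorph A)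
  mem_chart_source A := by simp
  chart_mem_atlas A := ⟨_, chart_mem_atlas _ _, rfl⟩

instance : IsManifold sp11ModelWithCorners ∞ Sp11 where
  compatible := by
    rintro _ _ ⟨f, hf, rfl⟩ ⟨g, hg, rfl⟩
    have h := HasGroupoid.compatible (G := contDiffGroupoid ∞ sp11ModelWithCorners) hf hg
    have e : (sp11Homeomorph.toOpenPartialHomeomorph ≫ₕ f).symm ≫ₕ
        (sp11Homeomorph.toOpenPartialHomeomorph ≫ₕ g) = f.symm ≫ₕ g := by
      rw [OpenPartialHomeomorph.trans_symm_eq_symm_trans_symm, OpenPartialHomeomorph.trans_assoc,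
        ← OpenPartialHomeomorph.trans_assoc _ _ g, ← Homeomorph.symm_toOpenPartialHomeomorph,
        ← Homeomorph.trans_toOpenPartialHomeomorph, Homeomorph.symm_trans_self,
        Homeomorph.refl_toOpenPartialHomeomorph, OpenPartialHomeomorph.refl_trans]
    rwa [e]

theorem contDiff_star_quaternion : ContDiff ℝ ∞ (star : ℍ[ℝ] → ℍ[ℝ]) :=
  (LinearMap.toContinuousLinearMap
    { toFun := (star : ℍ[ℝ] → ℍ[ℝ])
      map_add' := star_add
      map_smul' := fun r q => Quaternion.star_smul r q }).contDiff

theorem extChartAt_sp11 (A : Sp11) : extChartAt sp11ModelWithCorners A =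
    sp11Homeomorph.toEquiv.toPartialEquiv.trans
      (extChartAt sp11ModelWithCorners (sp11Homeomorph A)) :=
  PartialEquiv.trans_assoc _ _ _

theorem contMDiff_sp11Homeomorph :
    ContMDiff sp11ModelWithCorners sp11ModelWithCorners ∞ sp11Homeomorph := by
  rw [contMDiff_iff]
  refine ⟨sp11Homeomorph.continuous, fun A x => ?_⟩
  have h := (contMDiff_iff.mp (contMDiff_id (I := sp11ModelWithCorners) (n := ∞)
    (M := Sp11Param))).2 (sp11Homeomorph A) x
  rw [extChartAt_sp11]
  refine (h.mono ?_).congr ?_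
  · rintro y ⟨hy, hy'⟩
    refine ⟨hy.1, ?_⟩
    simpa using hy'
  · intro y _
    simp

theorem contMDiff_sp11Homeomorph_symm :
    ContMDiff sp11ModelWithCorners sp11ModelWithCorners ∞ sp11Homeomorph.symm := by
  rw [contMDiff_iff]
  refine ⟨sp11Homeomorph.symm.continuous, fun x A => ?_⟩
  have h := (contMDiff_iff.mp (contMDiff_id (I := sp11ModelWithCorners) (n := ∞)
    (M := Sp11Param))).2 x (sp11Homeomorph A)
  rw [extChartAt_sp11]
  refine (h.mono ?_).congr ?_
  · rintro y ⟨hy, hy'⟩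
    refine ⟨hy, ?_⟩
    simpa using hy'
  · intro y _
    simp

section Smooth

variable {E : Type*} [NormedAddCommGroup E] [NormedSpace ℝ E] {H : Type*} [TopologicalSpace H]
  {I : ModelWithCorners ℝ E H} {N : Type*} [TopologicalSpace N] [ChartedSpace H N]
  [IsManifold I ∞ N]

/-- The entries are smooth functions on `Sp(1,1)`. -/
theorem Sp11.contMDiff_entry (i j : Fin 2) :
    ContMDiff sp11ModelWithCorners 𝓘(ℝ, ℍ[ℝ]) ∞ fun A : Sp11 => A.1 i j := by
  suffices h : ContMDiff sp11ModelWithCorners 𝓘(ℝ, ℍ[ℝ]) ∞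
      fun x : Sp11Param => (sp11OfParam x).1 i j by
    convert h.comp contMDiff_sp11Homeomorph using 2 with A
    exact congrArg (fun B : Sp11 => B.1 i j) (sp11OfParam_toParam A).symm
  have hb : ContMDiff sp11ModelWithCorners 𝓘(ℝ, ℍ[ℝ]) ∞ fun x : Sp11Param => x.1 := contMDiff_fst
  have hu : ContMDiff sp11ModelWithCorners 𝓘(ℝ, ℍ[ℝ]) ∞
      fun x : Sp11Param => (x.2.1 : ℍ[ℝ]) :=
    contMDiff_coe_sphere.comp (contMDiff_fst.comp contMDiff_snd)
  have hv : ContMDiff sp11ModelWithCorners 𝓘(ℝ, ℍ[ℝ]) ∞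
      fun x : Sp11Param => (x.2.2 : ℍ[ℝ]) :=
    contMDiff_coe_sphere.comp (contMDiff_snd.comp contMDiff_snd)
  have hs : ContMDiff sp11ModelWithCorners 𝓘(ℝ, ℝ) ∞
      fun x : Sp11Param => √(1 + ‖x.1‖ ^ 2) := by
    have : ContDiff ℝ ∞ fun b : ℍ[ℝ] => √(1 + ‖b‖ ^ 2) :=
      (contDiff_const.add (contDiff_norm_sq ℝ)).sqrt fun b => by positivity
    exact this.contMDiff.comp hb
  have hbs : ContMDiff sp11ModelWithCorners 𝓘(ℝ, ℍ[ℝ]) ∞ fun x : Sp11Param => star x.1 :=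
    contDiff_star_quaternion.contMDiff.comp hb
  have hmul : ContDiff ℝ ∞ fun p : ℍ[ℝ] × ℍ[ℝ] => p.1 * p.2 := contDiff_mul
  fin_cases i <;> fin_cases j
  · exact hs.smul hu
  · exact hmul.contMDiff.comp ((hmul.contMDiff.comp (hu.prodMk_space hbs)).prodMk_space hv)
  · exact hb
  · exact hs.smul hv

/-- A map into `Sp(1,1)` is smooth if and only if it is smooth as a map into the space of
matrices. -/
theorem Sp11.contMDiff_iff {f : N → Sp11} :
    ContMDiff I sp11ModelWithCorners ∞ f ↔
      ∀ i j, ContMDiff I 𝓘(ℝ, ℍ[ℝ]) ∞ fun x => (f x).1 i j := by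
  refine ⟨fun h i j => (Sp11.contMDiff_entry i j).comp h, fun h => ?_⟩
  have hn : ContDiffOn ℝ ∞ (fun q : ℍ[ℝ] => ‖q‖⁻¹ • q) {0}ᶜ := fun q hq =>
    ((((contDiffAt_norm ℝ hq).inv (norm_ne_zero_iff.mpr hq)).smul
      contDiffAt_id)).contDiffWithinAt
  suffices hp : ContMDiff I sp11ModelWithCorners ∞ fun x => sp11Homeomorph (f x) by
    convert contMDiff_sp11Homeomorph_symm.comp hp using 1
    funext x
    exact (sp11Homeomorph.symm_apply_apply (f x)).symm
  refine (h 1 0).prodMk (.prodMk (.codRestrict_sphere ?_ _) (.codRestrict_sphere ?_ _))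
  · exact hn.contMDiffOn.comp_contMDiff (h 0 0) fun x => (f x).a_ne_zero
  · exact hn.contMDiffOn.comp_contMDiff (h 1 1) fun x => (f x).d_ne_zero

end Smooth

instance : LieGroup sp11ModelWithCorners ∞ Sp11 where
  contMDiff_mul := by
    rw [Sp11.contMDiff_iff]
    intro i j
    have hmul : ContDiff ℝ ∞ fun p : ℍ[ℝ] × ℍ[ℝ] => p.1 * p.2 := contDiff_mul
    have h : ∀ k, ContMDiff (sp11ModelWithCorners.prod sp11ModelWithCorners) 𝓘(ℝ, ℍ[ℝ]) ∞
        fun x : Sp11 × Sp11 => x.1.1 i k * x.2.1 k j := fun k =>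
      hmul.contMDiff.comp (((Sp11.contMDiff_entry i k).comp contMDiff_fst).prodMk_space
        ((Sp11.contMDiff_entry k j).comp contMDiff_snd))
    simp only [Sp11.coe_mul, Matrix.mul_apply, Fin.sum_univ_two]
    exact (h 0).add (h 1)
  contMDiff_inv := by
    rw [Sp11.contMDiff_iff]
    have h : ∀ i j, ContMDiff sp11ModelWithCorners 𝓘(ℝ, ℍ[ℝ]) ∞
        fun A : Sp11 => star (A.1 i j) := fun i j =>
      contDiff_star_quaternion.contMDiff.comp (Sp11.contMDiff_entry i j)
    intro i j
    fin_cases i <;> fin_cases j <;>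
      simp [Sp11.coe_inv, signatureMatrix, Matrix.mul_apply, Matrix.vecMul, dotProduct,
        Fin.sum_univ_two]
    · exact h 0 0
    · exact (h 1 0).neg
    · exact (h 0 1).neg
    · exact h 1 1

/-- `Sp(1,1)` carries the topology induced from the space of matrices. -/
theorem Sp11.isEmbedding_entries :
    Topology.IsEmbedding (fun (A : Sp11) (i j : Fin 2) => A.1 i j) :=
  Topology.IsEmbedding.subtypeVal (p := fun A : Matrix (Fin 2) (Fin 2) ℍ[ℝ] =>
    Aᴴ * signatureMatrix * A = signatureMatrix)

/-- The inclusion of `Sp(1,1)` into the space of matrices is an immersion. -/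
theorem Sp11.injective_mfderiv_entries (A : Sp11) :
    Function.Injective (mfderiv sp11ModelWithCorners 𝓘(ℝ, Fin 2 → Fin 2 → ℍ[ℝ])
      (fun (A : Sp11) (i j : Fin 2) => A.1 i j) A) := by
  let ι : Sp11 → Fin 2 → Fin 2 → ℍ[ℝ] := fun A i j => A.1 i j
  let j : Sp11Param → ℍ[ℝ] × ℍ[ℝ] × ℍ[ℝ] := Prod.map id (Prod.map (↑) (↑))
  let g : (Fin 2 → Fin 2 → ℍ[ℝ]) → ℍ[ℝ] × ℍ[ℝ] × ℍ[ℝ] := fun m =>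
    (m 1 0, ‖m 0 0‖⁻¹ • m 0 0, ‖m 1 1‖⁻¹ • m 1 1)
  have hι : ContMDiff sp11ModelWithCorners 𝓘(ℝ, Fin 2 → Fin 2 → ℍ[ℝ]) ∞ ι :=
    contMDiff_pi_space.mpr fun i => contMDiff_pi_space.mpr fun j => Sp11.contMDiff_entry i j
  let J : ModelWithCorners ℝ (ℍ[ℝ] × ℍ[ℝ] × ℍ[ℝ]) (ModelProd ℍ[ℝ] (ModelProd ℍ[ℝ] ℍ[ℝ])) :=
    𝓘(ℝ, ℍ[ℝ]).prod (𝓘(ℝ, ℍ[ℝ]).prod 𝓘(ℝ, ℍ[ℝ]))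
  have hg : MDifferentiableAt 𝓘(ℝ, Fin 2 → Fin 2 → ℍ[ℝ]) J g (ι A) := by
    have e : ∀ i k, DifferentiableAt ℝ (fun m : Fin 2 → Fin 2 → ℍ[ℝ] => m i k) (ι A) := by
      intro i k
      fun_prop
    refine (e 1 0).mdifferentiableAt.prodMk (.prodMk (DifferentiableAt.mdifferentiableAt ?_)
      (DifferentiableAt.mdifferentiableAt ?_))
    · exact (((e 0 0).norm ℝ A.a_ne_zero).inv (norm_ne_zero_iff.mpr A.a_ne_zero)).smul (e 0 0)
    · exact (((e 1 1).norm ℝ A.d_ne_zero).inv (norm_ne_zero_iff.mpr A.d_ne_zero)).smul (e 1 1)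
  have hS : ∀ u : Sp1, MDifferentiableAt (𝓡 3) 𝓘(ℝ, ℍ[ℝ]) ((↑) : Sp1 → ℍ[ℝ]) u := fun u =>
    (contMDiff_coe_sphere (m := ∞)).mdifferentiable (by simp) u
  have hj : MDifferentiableAt sp11ModelWithCorners J j (sp11Homeomorph A) :=
    mdifferentiableAt_id.prodMap ((hS _).prodMap (hS _))
  have hj' : Function.Injective (mfderiv sp11ModelWithCorners J j (sp11Homeomorph A)) := by
    have h1 : mfderiv sp11ModelWithCorners J j (sp11Homeomorph A) = _ :=
      mfderiv_prodMap mdifferentiableAt_id ((hS _).prodMap (hS _))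
    rw [h1, mfderiv_prodMap (hS _) (hS _), mfderiv_id]
    exact Function.injective_id.prodMap
      ((injective_mvfderiv_subtypeVal_sphere (E := ℍ[ℝ]) (n := 3) _).prodMap
        (injective_mvfderiv_subtypeVal_sphere (E := ℍ[ℝ]) (n := 3) _))
  have hΦ : MDifferentiableAt sp11ModelWithCorners sp11ModelWithCorners sp11Homeomorph A :=
    contMDiff_sp11Homeomorph.mdifferentiable (by simp) A
  have hΨ : MDifferentiableAt sp11ModelWithCorners sp11ModelWithCorners sp11Homeomorph.symm
      (sp11Homeomorph A) :=
    contMDiff_sp11Homeomorph_symm.mdifferentiable (by simp) _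
  have hΦ' : Function.Injective
      (mfderiv sp11ModelWithCorners sp11ModelWithCorners sp11Homeomorph A) := by
    have h := mfderiv_comp A hΨ hΦ
    rw [show sp11Homeomorph.symm ∘ sp11Homeomorph = id from
      funext sp11Homeomorph.symm_apply_apply, mfderiv_id] at h
    intro v w hvw
    have hv := congrArg (fun L => L v) h
    have hw := congrArg (fun L => L w) h
    exact hv.trans ((congrArg _ hvw).trans hw.symm)
  have h1 := mfderiv_comp A hj hΦ
  have h2 := mfderiv_comp A hg (hι.mdifferentiable (by simp) A)
  have h3 : j ∘ sp11Homeomorph = g ∘ ι := rfl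
  rw [h3, h2] at h1
  intro v w hvw
  have hv := congrArg (fun L => L v) h1
  have hw := congrArg (fun L => L w) h1
  exact hΦ' (hj' (hv.symm.trans ((congrArg _ hvw).trans hw)))

/-! ### The subgroup `Sp(1) I₂` and its right translations -/

/-- The homomorphism `u ↦ u I₂` from `Sp(1)` to `Sp(1,1)`. -/
def scalarHom : Sp1 →* Sp11 where
  toFun u := ⟨Matrix.diagonal fun _ => (u : ℍ[ℝ]), by
    rw [mem_Sp11_iff]
    simp⟩
  map_one' := Subtype.ext (by simp [Sp11.coe_one])
  map_mul' u v := Subtype.ext <|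
    (Matrix.diagonal_mul_diagonal (fun _ => (u : ℍ[ℝ])) (fun _ => (v : ℍ[ℝ]))).symm

/-- The subgroup `Sp(1) I₂` of `Sp(1,1)`. -/
def scalarSubgroup : Subgroup Sp11 := scalarHom.range

/-- The action of `Sp(1)` on `Sp(1,1)` by right translations, `(A, u) ↦ A (u I₂)`. -/
def rightTranslation (A : Sp11) (u : Sp1) : Sp11 := A * scalarHom u

/-! ### Slice regular functions on the ball and regular Möbius transformations -/

/-- `f(q) = ∑ qⁿ aₙ` on the unit ball, which is the power series expansion that every slice regular
function on the ball has. The coefficients are determined by `f`. -/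
def HasExpansion (f : UnitBall → ℍ[ℝ]) (a : ℕ → ℍ[ℝ]) : Prop :=
  ∀ q : UnitBall, HasSum (fun n => (q : ℍ[ℝ]) ^ n * a n) (f q)

open Classical in
/-- The coefficients of the power series expansion of `f` (zero if there is none). -/
def coeff (f : UnitBall → ℍ[ℝ]) : ℕ → ℍ[ℝ] :=
  if h : ∃ a, HasExpansion f a then h.choose else 0

/-- The function `q ↦ ∑ qⁿ aₙ` on the unit ball. -/
def ofCoeff (a : ℕ → ℍ[ℝ]) : UnitBall → ℍ[ℝ] := fun q => ∑' n, (q : ℍ[ℝ]) ^ n * a n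

/-- The regular product `f * g`, with coefficients `∑ₖ aₖ bₙ₋ₖ`. -/
def starMul (f g : UnitBall → ℍ[ℝ]) : UnitBall → ℍ[ℝ] :=
  ofCoeff fun n => ∑ k ∈ Finset.range (n + 1), coeff f k * coeff g (n - k)

/-- The regular conjugate `fᶜ`, with conjugated coefficients. -/
def regularConj (f : UnitBall → ℍ[ℝ]) : UnitBall → ℍ[ℝ] := ofCoeff fun n => star (coeff f n)

/-- The symmetrization `fˢ = f * fᶜ`. -/
def symmetrization (f : UnitBall → ℍ[ℝ]) : UnitBall → ℍ[ℝ] := starMul f (regularConj f)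

/-- The regular reciprocal `(1 / fˢ) fᶜ`, meaningful off the zeros of `fˢ`. -/
def starInv (f : UnitBall → ℍ[ℝ]) : UnitBall → ℍ[ℝ] :=
  fun q => (symmetrization f q)⁻¹ * regularConj f q

/-- The slice regular function `q ↦ q a + b`. -/
def linearFun (a b : ℍ[ℝ]) : UnitBall → ℍ[ℝ] := fun q => (q : ℍ[ℝ]) * a + b

/-- The regular Möbius transformation `𝓕_A(q) = (q c + d)^{-*} * (q a + b)` of
`A = (a c; b d) ∈ Sp(1,1)`. -/
def regularMoebius (A : Sp11) : UnitBall → ℍ[ℝ] :=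
  starMul (starInv (linearFun (A.1 0 1) (A.1 1 1))) (linearFun (A.1 0 0) (A.1 1 0))

/-- The set `𝓜(𝔹)` of the regular Möbius transformations `𝓕_A`, `A ∈ Sp(1,1)`. As a type of its
own it carries no topology. -/
def MoebiusB : Type := {f : UnitBall → ℍ[ℝ] // ∃ A : Sp11, regularMoebius A = f}

/-- The map `Sp(1,1) → 𝓜(𝔹)`, `A ↦ 𝓕_{A⁻¹}`. -/
def moebiusProj (A : Sp11) : MoebiusB := ⟨regularMoebius A⁻¹, A⁻¹, rfl⟩

/-! ### Manifolds, submersions and principal fiber bundles -/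

section Bundles

variable {EP : Type*} [NormedAddCommGroup EP] [NormedSpace ℝ EP] {HP : Type*} [TopologicalSpace HP]
  (IP : ModelWithCorners ℝ EP HP)
  {EM : Type*} [NormedAddCommGroup EM] [NormedSpace ℝ EM] {HM : Type*} [TopologicalSpace HM]
  (IM : ModelWithCorners ℝ EM HM)
  {EG : Type*} [NormedAddCommGroup EG] [NormedSpace ℝ EG] {HG : Type*} [TopologicalSpace HG]
  (IG : ModelWithCorners ℝ EG HG)
  {P : Type*} [TopologicalSpace P] [ChartedSpace HP P]
  {M : Type*} [TopologicalSpace M] [ChartedSpace HM M]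
  {G : Type*} [TopologicalSpace G] [ChartedSpace HG G] [Group G]

/-- `M` is a smooth finite-dimensional manifold without boundary, Hausdorff and second
countable. -/
structure IsSmoothManifold (M : Type*) [TopologicalSpace M] [ChartedSpace HM M] : Prop where
  finiteDimensional : FiniteDimensional ℝ EM
  boundaryless : IM.Boundaryless
  isManifold : IsManifold IM ∞ M
  t2 : T2Space M
  secondCountable : SecondCountableTopology M

/-- A submersion: a surjective smooth map whose differential at every point is surjective. -/
structure IsSurjSubmersion (f : P → M) : Prop where
  surjective : Function.Surjective f
  smooth : ContMDiff IP IM ∞ f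
  surjective_mfderiv : ∀ p, Function.Surjective (mfderiv IP IM f p)

/-- `π : P → M` is a principal fiber bundle with structure Lie group `G`, for the right action
`(p, g) ↦ act p g` of `G` on `P`. -/
structure IsPrincipalFiberBundle (act : P → G → P) (π : P → M) : Prop where
  total : IsSmoothManifold IP P
  base : IsSmoothManifold IM M
  group : IsSmoothManifold IG G
  lieGroup : LieGroup IG ∞ G
  submersion : IsSurjSubmersion IP IM π
  act_one : ∀ p, act p 1 = p
  act_mul : ∀ p g h, act p (g * h) = act (act p g) h
  smooth_act : ContMDiff (IP.prod IG) IP ∞ fun x : P × G => act x.1 x.2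
  free : ∀ p g, act p g = p → g = 1
  proper : ∀ K : Set P, IsCompact K → IsCompact {g : G | ((act · g) '' K ∩ K).Nonempty}
  orbit_eq_fiber : ∀ p, Set.range (act p) = π ⁻¹' {π p}
  /-- Local triviality: an equivariant diffeomorphism from `U × G` onto `π⁻¹(U)` over `U`. -/
  locallyTrivial : ∀ m : M, ∃ U : Set M, IsOpen U ∧ m ∈ U ∧
    ∃ φ : PartialDiffeomorph (IM.prod IG) IP (M × G) P ∞,
      φ.source = U ×ˢ Set.univ ∧ φ.target = π ⁻¹' U ∧
      ∀ x ∈ U, ∀ g : G, π (φ (x, g)) = x ∧ ∀ h : G, φ (x, g * h) = act (φ (x, g)) h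

end Bundles

/-! ### The manifold structure of `𝓜(𝔹)` -/

/-- A structure of smooth `n`-dimensional manifold on a set. -/
structure SmoothStructure (n : ℕ) (X : Type*) where
  top : TopologicalSpace X
  charts : ChartedSpace (EuclideanSpace ℝ (Fin n)) X
  isSmoothManifold : IsSmoothManifold (𝓡 n) X

/-- Two manifold structures on a set are the same if the identity is a diffeomorphism between
them. -/
def SmoothStructure.Same {n : ℕ} {X : Type*} (S T : SmoothStructure n X) : Prop :=
  @ContMDiff ℝ _ _ _ _ _ _ (𝓡 n) X S.top S.charts _ _ _ _ _ (𝓡 n) X T.top T.charts ∞ id ∧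
    @ContMDiff ℝ _ _ _ _ _ _ (𝓡 n) X T.top T.charts _ _ _ _ _ (𝓡 n) X S.top S.charts ∞ id

/-- The manifold structure `S` of `𝓜(𝔹)` is the quotient one: the assignment
`A Sp(1)I₂ ↦ 𝓕_{A⁻¹}` is a diffeomorphism onto `𝓜(𝔹)` from the quotient `Sp(1,1) / Sp(1)I₂`, where
the quotient has the quotient topology and a manifold structure for which the quotient map is a
submersion. -/
def IsQuotientStructure (S : SmoothStructure 7 MoebiusB) : Prop :=
  letI := S.top
  letI := S.charts
  ∃ _ : ChartedSpace (EuclideanSpace ℝ (Fin 7)) (Sp11 ⧸ scalarSubgroup),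
    IsSmoothManifold (𝓡 7) (Sp11 ⧸ scalarSubgroup) ∧
    IsSurjSubmersion sp11ModelWithCorners (𝓡 7)
      (fun A : Sp11 => (A : Sp11 ⧸ scalarSubgroup)) ∧
    ∃ e : (Sp11 ⧸ scalarSubgroup) ≃ₘ^∞⟮𝓡 7, 𝓡 7⟯ MoebiusB,
      ∀ A : Sp11, e (A : Sp11 ⧸ scalarSubgroup) = moebiusProj A

/-- `A ↦ 𝓕_{A⁻¹}` is a principal fiber bundle with total space `Sp(1,1)`, base space `𝓜(𝔹)` with
the manifold structure `S`, and structure group `Sp(1)` acting by right translations. -/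
def IsMoebiusBundle (S : SmoothStructure 7 MoebiusB) : Prop :=
  letI := S.top
  letI := S.charts
  IsPrincipalFiberBundle sp11ModelWithCorners (𝓡 7) (𝓡 3) rightTranslation moebiusProj

end QuatMoebius

end

/-!
For `‖c‖ < ‖d‖` and `q ∈ 𝔹` the equation `x d + q x c = 1` has exactly one solution `x`, namely the
value at `q` of the regular reciprocal `(q c + d)^{-*}`. Conjugating `q` by `x` rewrites `𝓕_A(q)` as
a value `(d + t c)⁻¹ (b + t a)` with `|t| = |q|`, and the relations between the entries of `A` give
`|𝓕_A(q)| < 1`.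

Every matrix in `Sp(1,1)` is `(s, x̅ y; x, s y) (g I₂)` with `s = √(1 + |x|²)` for exactly one
`(x, y, g) ∈ ℍ × Sp(1) × Sp(1)`, so that `Sp(1,1)` is a trivial principal `Sp(1)`-bundle over
`ℍ × Sp(1)`. The first two coefficients of `𝓕_{A⁻¹}` are `-s⁻¹ x` and `s⁻² y`; hence `A ↦ 𝓕_{A⁻¹}`
separates exactly the orbits of the right translations. A submersion is a topological quotient map
through which smooth maps descend, so two submersions with the same fibers have diffeomorphic
targets. Therefore a manifold structure on `𝓜(𝔹)` is the quotient one if and only if `A ↦ 𝓕_{A⁻¹}`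
is a submersion for it, there is exactly one such structure, and it identifies `𝓜(𝔹)` with
`ℍ × Sp(1)`.
-/

noncomputable section

namespace QuatMoebius

/-! ### Power series on the ball -/

section Geometric

theorem eq_of_mul_add_mul_mul_eq {R : Type*} [NormedRing R] [NormMulClass R] {q c d x y : R}
    (h : ‖q‖ * ‖c‖ < ‖d‖) (hxy : x * d + q * x * c = y * d + q * y * c) : x = y := by
  have hdiff : (x - y) * d = -(q * (x - y) * c) := by
    rw [sub_mul, mul_sub, sub_mul, neg_sub, sub_eq_sub_iff_add_eq_add, hxy, add_comm]
  have hnorm : ‖x - y‖ * (‖d‖ - ‖q‖ * ‖c‖) = 0 := by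
    have := congrArg norm hdiff
    rw [norm_neg, norm_mul, norm_mul, norm_mul] at this
    linear_combination this
  exact sub_eq_zero.mp <| norm_eq_zero.mp <|
    (mul_eq_zero.mp hnorm).resolve_right (sub_pos.mpr h).ne'

variable {R : Type*} [NormedRing R] [NormOneClass R] [CompleteSpace R] {q r : R}

theorem summable_pow_mul_pow (h : ‖q‖ * ‖r‖ < 1) : Summable fun n : ℕ => q ^ n * r ^ n := by
  refine .of_norm_bounded (summable_geometric_of_lt_one (by positivity) h) fun n => ?_
  rw [mul_pow]
  exact (norm_mul_le _ _).trans
    (mul_le_mul (norm_pow_le _ _) (norm_pow_le _ _) (norm_nonneg _) (by positivity))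

theorem tsum_pow_mul_pow_eq (h : ‖q‖ * ‖r‖ < 1) :
    ∑' n : ℕ, q ^ n * r ^ n = 1 + q * (∑' n : ℕ, q ^ n * r ^ n) * r := by
  have hs := summable_pow_mul_pow h
  conv_lhs => rw [hs.tsum_eq_zero_add]
  rw [← hs.tsum_mul_left, ← (hs.mul_left q).tsum_mul_right]
  simp only [pow_zero, mul_one, pow_succ', ← (Commute.self_pow r _).eq, mul_assoc]

end Geometric

section Expansion

variable {f : UnitBall → ℍ[ℝ]} {u v : ℕ → ℍ[ℝ]}

theorem norm_coe_unitBall_lt_one (q : UnitBall) : ‖(q : ℍ[ℝ])‖ < 1 := mem_ball_zero_iff.mp q.2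

/-- The power series `∑ tⁿ uₙ` in a real variable `t`, as a formal multilinear series. -/
def realPowerSeries (u : ℕ → ℍ[ℝ]) : FormalMultilinearSeries ℝ ℝ ℍ[ℝ] := fun n =>
  ContinuousMultilinearMap.mkPiRing ℝ (Fin n) (u n)

theorem coeff_realPowerSeries (u : ℕ → ℍ[ℝ]) (n : ℕ) : (realPowerSeries u).coeff n = u n := by
  simp [realPowerSeries, FormalMultilinearSeries.coeff]

theorem HasExpansion.hasFPowerSeriesAt (hf : HasExpansion f u) :
    HasFPowerSeriesAt (fun t : ℝ => ∑' n, t ^ n • u n) (realPowerSeries u) 0 := by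
  rw [hasFPowerSeriesAt_iff]
  filter_upwards [Metric.ball_mem_nhds (0 : ℝ) one_pos] with t ht
  have hsum := hf ⟨(t : ℍ[ℝ]), by simpa using ht⟩
  simp only [← Quaternion.coe_pow, Quaternion.coe_mul_eq_smul] at hsum
  simpa only [coeff_realPowerSeries, zero_add] using hsum.summable.hasSum

/-- The restriction to the real diameter is a real power series, which has unique coefficients. -/
theorem HasExpansion.unique (hu : HasExpansion f u) (hv : HasExpansion f v) : u = v := by
  have hseries : (fun t : ℝ => ∑' n, t ^ n • u n) =ᶠ[nhds 0] fun t : ℝ => ∑' n, t ^ n • v n := by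
    filter_upwards [Metric.ball_mem_nhds (0 : ℝ) one_pos] with t ht
    let q : UnitBall := ⟨(t : ℍ[ℝ]), by simpa using ht⟩
    simpa only [q, ← Quaternion.coe_pow, Quaternion.coe_mul_eq_smul]
      using (hu q).tsum_eq.trans (hv q).tsum_eq.symm
  have hcoeff := (hu.hasFPowerSeriesAt.congr hseries).eq_formalMultilinearSeries
    hv.hasFPowerSeriesAt
  funext n
  rw [← coeff_realPowerSeries u, hcoeff, coeff_realPowerSeries]

theorem HasExpansion.coeff_eq (hf : HasExpansion f u) : coeff f = u := by
  have hex : ∃ u, HasExpansion f u := ⟨u, hf⟩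
  rw [coeff, dif_pos hex]
  exact hex.choose_spec.unique hf

/-- The power series coefficients `b, a, 0, 0, …` of `linearFun a b`. -/
def linearCoeff (a b : ℍ[ℝ]) : ℕ → ℍ[ℝ]
  | 0 => b
  | 1 => a
  | _ + 2 => 0

theorem hasExpansion_linearFun (a b : ℍ[ℝ]) : HasExpansion (linearFun a b) (linearCoeff a b) := by
  intro q
  rw [← hasSum_nat_add_iff' 2]
  simp [Finset.sum_range_succ, linearCoeff, linearFun, add_comm, hasSum_zero]

theorem regularConj_linearFun (a b : ℍ[ℝ]) :
    regularConj (linearFun a b) = linearFun (star a) (star b) := by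
  funext q
  rw [regularConj, (hasExpansion_linearFun a b).coeff_eq, ofCoeff,
    ← (hasExpansion_linearFun (star a) (star b) q).tsum_eq]
  refine tsum_congr fun n => ?_
  rcases n with _ | _ | n <;> simp [linearCoeff]

theorem sum_mul_linearCoeff_succ (u : ℕ → ℍ[ℝ]) (a b : ℍ[ℝ]) (n : ℕ) :
    ∑ k ∈ Finset.range (n + 2), u k * linearCoeff a b (n + 1 - k) = u n * a + u (n + 1) * b := by
  have hvanish : ∀ k ∈ Finset.range n, u k * linearCoeff a b (n + 1 - k) = 0 := fun k hk => by
    obtain ⟨m, rfl⟩ := Nat.exists_eq_add_of_lt (Finset.mem_range.mp hk)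
    rw [show k + m + 1 + 1 - k = m + 2 by omega, linearCoeff, mul_zero]
  rw [Finset.sum_range_succ, Finset.sum_range_succ, Finset.sum_eq_zero hvanish, zero_add,
    Nat.add_sub_cancel_left, Nat.sub_self]
  rfl

theorem HasExpansion.hasSum_starMul_linearFun (hf : HasExpansion f u) (a b : ℍ[ℝ])
    (q : UnitBall) :
    HasSum (fun n => (q : ℍ[ℝ]) ^ n * ∑ k ∈ Finset.range (n + 1), u k * linearCoeff a b (n - k))
      (f q * b + q * f q * a) := by
  have hb := (hasSum_nat_add_iff' 1).mpr ((hf q).mul_right b)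
  have ha := ((hf q).mul_left (q : ℍ[ℝ])).mul_right a
  rw [← hasSum_nat_add_iff' 1]
  convert hb.add ha using 1
  · funext n
    rw [sum_mul_linearCoeff_succ, pow_succ']
    noncomm_ring
  · simp only [Finset.range_one, Finset.sum_singleton, linearCoeff, pow_zero, zero_add, one_mul,
      Nat.sub_zero]
    abel

theorem HasExpansion.starMul_linearFun_apply (hf : HasExpansion f u) (a b : ℍ[ℝ]) (q : UnitBall) :
    starMul f (linearFun a b) q = f q * b + q * f q * a := by
  rw [starMul, hf.coeff_eq, (hasExpansion_linearFun a b).coeff_eq]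
  exact (hf.hasSum_starMul_linearFun a b q).tsum_eq

theorem HasExpansion.starMul_linearFun (hf : HasExpansion f u) (a b : ℍ[ℝ]) :
    HasExpansion (starMul f (linearFun a b))
      fun n => ∑ k ∈ Finset.range (n + 1), u k * linearCoeff a b (n - k) := fun q => by
  rw [hf.starMul_linearFun_apply]
  exact hf.hasSum_starMul_linearFun a b q

end Expansion

/-! ### The regular reciprocal of a linear function -/

section Reciprocal

variable {c d : ℍ[ℝ]}

theorem norm_mul_lt_of_norm_lt (h : ‖c‖ < ‖d‖) (q : UnitBall) : ‖(q : ℍ[ℝ])‖ * ‖c‖ < ‖d‖ :=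
  (mul_le_of_le_one_left (norm_nonneg c) (norm_coe_unitBall_lt_one q).le).trans_lt h

theorem symmetrization_linearFun_apply (c d : ℍ[ℝ]) (q : UnitBall) :
    symmetrization (linearFun c d) q =
      d * star d + q * (d * star c + c * star d) + (q : ℍ[ℝ]) ^ 2 * (c * star c) := by
  rw [symmetrization, regularConj_linearFun,
    (hasExpansion_linearFun c d).starMul_linearFun_apply, linearFun]
  noncomm_ring

theorem mul_star_add_mul_star (c d : ℍ[ℝ]) :
    d * star c + c * star d = ((2 * (d * star c).re : ℝ) : ℍ[ℝ]) := by
  rw [← Quaternion.self_add_star', star_mul, star_star]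

theorem star_mul_add_star_mul (c d : ℍ[ℝ]) :
    star d * c + star c * d = d * star c + c * star d := by
  have h := mul_star_add_mul_star (star d) (star c)
  rw [star_star, star_star] at h
  rw [add_comm, h, mul_star_add_mul_star]
  congr 2
  simp only [Quaternion.re_mul, Quaternion.re_star, Quaternion.imI_star, Quaternion.imJ_star,
    Quaternion.imK_star]
  ring

/-- The coefficients of the symmetrization are real. -/
theorem commute_symmetrization_linearFun (c d : ℍ[ℝ]) (q : UnitBall) :
    Commute (symmetrization (linearFun c d) q) (q : ℍ[ℝ]) := by
  have hreal (t : ℝ) : Commute (t : ℍ[ℝ]) (q : ℍ[ℝ]) := Quaternion.coe_commutes t q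
  rw [symmetrization_linearFun_apply, mul_star_add_mul_star, Quaternion.self_mul_star,
    Quaternion.self_mul_star]
  exact ((hreal _).add_left ((Commute.refl _).mul_left (hreal _))).add_left
    (((Commute.refl _).pow_left 2).mul_left (hreal _))

theorem regularConj_linearFun_mul_add (c d : ℍ[ℝ]) (q : UnitBall) :
    regularConj (linearFun c d) q * d + q * regularConj (linearFun c d) q * c =
      symmetrization (linearFun c d) q := by
  have hexpand : ((q : ℍ[ℝ]) * star c + star d) * d + q * (q * star c + star d) * c =
      star d * d + q * (star d * c + star c * d) + (q : ℍ[ℝ]) ^ 2 * (star c * c) := by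
    noncomm_ring
  rw [symmetrization_linearFun_apply, regularConj_linearFun, linearFun, hexpand,
    star_mul_add_star_mul, Quaternion.star_mul_self, Quaternion.star_mul_self,
    Quaternion.self_mul_star, Quaternion.self_mul_star]

theorem symmetrization_linearFun_ne_zero (h : ‖c‖ < ‖d‖) (q : UnitBall) :
    symmetrization (linearFun c d) q ≠ 0 := fun h0 => by
  have hconj : regularConj (linearFun c d) q = 0 :=
    eq_of_mul_add_mul_mul_eq (norm_mul_lt_of_norm_lt h q)
      (by simpa using (regularConj_linearFun_mul_add c d q).trans h0)
  rw [regularConj_linearFun, linearFun] at hconj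
  have hone : (1 : ℍ[ℝ]) = 0 :=
    eq_of_mul_add_mul_mul_eq (c := star c) (d := star d) (q := (q : ℍ[ℝ]))
      (by simpa using norm_mul_lt_of_norm_lt h q) (by simpa [add_comm] using hconj)
  exact one_ne_zero hone

theorem starInv_linearFun_mul_add (h : ‖c‖ < ‖d‖) (q : UnitBall) :
    starInv (linearFun c d) q * d + q * starInv (linearFun c d) q * c = 1 := by
  rw [starInv, ← mul_assoc (q : ℍ[ℝ]),
    ← (commute_symmetrization_linearFun c d q).inv_left₀.eq, mul_assoc, mul_assoc, mul_assoc,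
    ← mul_add, ← mul_assoc (q : ℍ[ℝ]), regularConj_linearFun_mul_add,
    inv_mul_cancel₀ (symmetrization_linearFun_ne_zero h q)]

theorem starInv_linearFun_ne_zero (h : ‖c‖ < ‖d‖) (q : UnitBall) :
    starInv (linearFun c d) q ≠ 0 := fun h0 => by
  simpa [h0] using starInv_linearFun_mul_add h q

theorem hasExpansion_starInv_linearFun (h : ‖c‖ < ‖d‖) :
    HasExpansion (starInv (linearFun c d)) fun n => (-(d⁻¹ * c)) ^ n * d⁻¹ := by
  intro q
  have hd : d ≠ 0 := norm_pos_iff.mp ((norm_nonneg c).trans_lt h)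
  have hr : ‖(q : ℍ[ℝ])‖ * ‖-(d⁻¹ * c)‖ < 1 := by
    rw [norm_neg, norm_mul, norm_inv, mul_left_comm, inv_mul_lt_one₀ (norm_pos_iff.mpr hd)]
    exact norm_mul_lt_of_norm_lt h q
  have hsum := (summable_pow_mul_pow hr).hasSum.mul_right d⁻¹
  have hgeom := tsum_pow_mul_pow_eq hr
  set s := ∑' n : ℕ, (q : ℍ[ℝ]) ^ n * (-(d⁻¹ * c)) ^ n
  have hsol : s * d⁻¹ * d + q * (s * d⁻¹) * c = 1 := by
    rw [inv_mul_cancel_right₀ hd, ← sub_eq_iff_eq_add.mpr hgeom]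
    noncomm_ring
  rw [eq_of_mul_add_mul_mul_eq (norm_mul_lt_of_norm_lt h q)
    ((starInv_linearFun_mul_add h q).trans hsol.symm)]
  simpa only [mul_assoc] using hsum

end Reciprocal

/-! ### Regular Möbius transformations -/

theorem Sp11.inv_entries (A : Sp11) :
    (A⁻¹).1 = !![star (A.1 0 0), -star (A.1 1 0); -star (A.1 0 1), star (A.1 1 1)] := by
  ext i j : 1
  fin_cases i <;> fin_cases j <;> simp [Sp11.coe_inv, signatureMatrix, Matrix.mul_apply,
    Fin.sum_univ_two, Matrix.vecMul, dotProduct]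

theorem Sp11.row_entries (A : Sp11) :
    ‖A.1 0 0‖ ^ 2 = 1 + ‖A.1 0 1‖ ^ 2 ∧ ‖A.1 1 1‖ ^ 2 = 1 + ‖A.1 1 0‖ ^ 2 ∧
      A.1 0 0 * star (A.1 1 0) = A.1 0 1 * star (A.1 1 1) := by
  simpa [Sp11.inv_entries] using (A⁻¹).entries

theorem Sp11.norm_c_lt_norm_d (A : Sp11) : ‖A.1 0 1‖ < ‖A.1 1 1‖ :=
  lt_of_pow_lt_pow_left₀ 2 (norm_nonneg _) (by linarith [A.entries.2.1])

theorem Sp11.norm_sq_sub_norm_sq (A : Sp11) (t : ℍ[ℝ]) :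
    ‖A.1 1 1 + t * A.1 0 1‖ ^ 2 - ‖A.1 1 0 + t * A.1 0 0‖ ^ 2 = 1 - ‖t‖ ^ 2 := by
  obtain ⟨ha, hd, hac⟩ := A.row_entries
  have hinner : inner ℝ (A.1 1 1) (t * A.1 0 1) = inner ℝ (A.1 1 0) (t * A.1 0 0) := by
    rw [real_inner_comm, real_inner_comm (t * _), Quaternion.inner_def, Quaternion.inner_def,
      mul_assoc, mul_assoc, hac]
  rw [norm_add_sq_real, norm_add_sq_real, norm_mul, norm_mul, hinner]
  linear_combination hd - ‖t‖ ^ 2 * ha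

theorem regularMoebius_apply (A : Sp11) (q : UnitBall) :
    regularMoebius A q = starInv (linearFun (A.1 0 1) (A.1 1 1)) q * A.1 1 0 +
      q * starInv (linearFun (A.1 0 1) (A.1 1 1)) q * A.1 0 0 :=
  (hasExpansion_starInv_linearFun A.norm_c_lt_norm_d).starMul_linearFun_apply _ _ q

/-- Conjugating `q` by `s = (q c + d)^{-*}` turns `𝓕_A(q)` into the value
`(d + t c)⁻¹ (b + t a)` of a classical Möbius transformation at a point `t` with `|t| = |q|`. -/
theorem regularMoebius_mem_ball (A : Sp11) (q : UnitBall) :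
    regularMoebius A q ∈ Metric.ball (0 : ℍ[ℝ]) 1 := by
  have hsol := starInv_linearFun_mul_add A.norm_c_lt_norm_d q
  have hs := starInv_linearFun_ne_zero A.norm_c_lt_norm_d q
  have hF := regularMoebius_apply A q
  set s := starInv (linearFun (A.1 0 1) (A.1 1 1)) q
  obtain ⟨t, hst⟩ : ∃ t, q * s = s * t := ⟨s⁻¹ * (q * s), (mul_inv_cancel_left₀ hs _).symm⟩
  have ht : ‖t‖ < 1 := by
    have hnorm := congrArg norm hst
    rw [norm_mul, norm_mul, mul_comm, mul_right_inj' (norm_ne_zero_iff.mpr hs)] at hnorm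
    exact hnorm ▸ norm_coe_unitBall_lt_one q
  rw [hst, mul_assoc, ← mul_add] at hF hsol
  have hlt : ‖A.1 1 0 + t * A.1 0 0‖ < ‖A.1 1 1 + t * A.1 0 1‖ := by
    have hpos : ‖t‖ ^ 2 < 1 := pow_lt_one₀ (norm_nonneg t) ht two_ne_zero
    exact lt_of_pow_lt_pow_left₀ 2 (norm_nonneg _) (by linarith [A.norm_sq_sub_norm_sq t])
  rw [mem_ball_zero_iff]
  calc ‖regularMoebius A q‖ = ‖s‖ * ‖A.1 1 0 + t * A.1 0 0‖ := by rw [hF, norm_mul]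
    _ < ‖s‖ * ‖A.1 1 1 + t * A.1 0 1‖ := mul_lt_mul_of_pos_left hlt (norm_pos_iff.mpr hs)
    _ = 1 := by rw [← norm_mul, hsol, norm_one]

theorem scalarHom_mul_apply (u : Sp1) (A : Sp11) (i j : Fin 2) :
    (scalarHom u * A).1 i j = u * A.1 i j :=
  Matrix.diagonal_mul (fun _ => (u : ℍ[ℝ])) A.1 i j

theorem rightTranslation_apply (A : Sp11) (u : Sp1) (i j : Fin 2) :
    (rightTranslation A u).1 i j = A.1 i j * u :=
  Matrix.mul_diagonal (fun _ => (u : ℍ[ℝ])) A.1 i j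

theorem regularMoebius_scalarHom_mul (u : Sp1) (A : Sp11) :
    regularMoebius (scalarHom u * A) = regularMoebius A := by
  funext q
  have hlt := A.norm_c_lt_norm_d
  have hlt' : ‖u * A.1 0 1‖ < ‖u * A.1 1 1‖ := by simpa [norm_mul] using hlt
  have hs : starInv (linearFun (u * A.1 0 1) (u * A.1 1 1)) q * u =
      starInv (linearFun (A.1 0 1) (A.1 1 1)) q := by
    refine eq_of_mul_add_mul_mul_eq (norm_mul_lt_of_norm_lt hlt q) ?_
    rw [starInv_linearFun_mul_add hlt, ← starInv_linearFun_mul_add hlt' q]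
    noncomm_ring
  rw [regularMoebius_apply, regularMoebius_apply, ← hs]
  simp only [scalarHom_mul_apply, mul_assoc]

theorem hasExpansion_regularMoebius (A : Sp11) :
    HasExpansion (regularMoebius A) fun n => ∑ k ∈ Finset.range (n + 1),
      (-((A.1 1 1)⁻¹ * A.1 0 1)) ^ k * (A.1 1 1)⁻¹ * linearCoeff (A.1 0 0) (A.1 1 0) (n - k) :=
  (hasExpansion_starInv_linearFun A.norm_c_lt_norm_d).starMul_linearFun _ _

theorem coeff_regularMoebius_zero (A : Sp11) :
    coeff (regularMoebius A) 0 = (A.1 1 1)⁻¹ * A.1 1 0 := by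
  simp [(hasExpansion_regularMoebius A).coeff_eq, linearCoeff]

theorem Sp11.schurComplement_eq (A : Sp11) :
    A.1 0 0 - A.1 0 1 * (A.1 1 1)⁻¹ * A.1 1 0 = (star (A.1 0 0))⁻¹ := by
  obtain ⟨ha, -, hac⟩ := A.entries
  have hne : star (A.1 0 0) ≠ 0 := star_ne_zero.mpr A.a_ne_zero
  rw [← mul_right_inj' hne, mul_inv_cancel₀ hne, mul_sub, ← mul_assoc, ← mul_assoc, hac,
    mul_inv_cancel_right₀ A.d_ne_zero, Quaternion.star_mul_self, Quaternion.star_mul_self,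
    ← Quaternion.coe_sub, Quaternion.normSq_eq_norm_mul_self, Quaternion.normSq_eq_norm_mul_self,
    ← pow_two, ← pow_two, ha, add_sub_cancel_right, Quaternion.coe_one]

theorem coeff_regularMoebius_one (A : Sp11) :
    coeff (regularMoebius A) 1 = (A.1 1 1)⁻¹ * (star (A.1 0 0))⁻¹ := by
  rw [(hasExpansion_regularMoebius A).coeff_eq, ← A.schurComplement_eq]
  refine (sum_mul_linearCoeff_succ _ _ _ 0).trans ?_
  noncomm_ring

theorem star_coe_Sp1 (u : Sp1) : star (u : ℍ[ℝ]) = (u : ℍ[ℝ])⁻¹ := by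
  rw [Quaternion.inv_def, Quaternion.normSq_eq_norm_mul_self, norm_Sp1, one_mul, inv_one, one_smul]

/-! ### Submersions -/

section Submersion

theorem exists_contDiffAt_section {𝕜 E F : Type*} [RCLike 𝕜] [NormedAddCommGroup E]
    [NormedSpace 𝕜 E] [NormedAddCommGroup F] [NormedSpace 𝕜 F] [FiniteDimensional 𝕜 F]
    {n : WithTop ℕ∞} {f : E → F} {x : E} (hf : ContDiffAt 𝕜 n f x) (hn : n ≠ 0)
    (hsurj : Function.Surjective (fderiv 𝕜 f x)) :
    ∃ s : F → E, ContDiffAt 𝕜 n s (f x) ∧ s (f x) = x ∧ ∀ᶠ y in nhds (f x), f (s y) = y := by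
  have : CompleteSpace F := FiniteDimensional.complete 𝕜 F
  obtain ⟨R, hR⟩ := (fderiv 𝕜 f x).exists_rightInverse_of_surjective
    (LinearMap.range_eq_top.mpr hsurj)
  let slice : F → E := fun y => x + R (y - f x)
  have hslice : slice (f x) = x := by simp [slice]
  have hslice_smooth : ContDiff 𝕜 n slice := by fun_prop
  have hslice_deriv : HasFDerivAt slice R (f x) := by
    simpa [slice] using
      (R.hasFDerivAt.comp (f x) ((hasFDerivAt_id (f x)).sub_const (f x))).const_add x
  have hcomp : ContDiffAt 𝕜 n (f ∘ slice) (f x) :=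
    .comp _ (hslice.symm ▸ hf) hslice_smooth.contDiffAt
  have hderiv : HasFDerivAt (f ∘ slice) (ContinuousLinearEquiv.refl 𝕜 F : F →L[𝕜] F) (f x) := by
    have hfx : HasFDerivAt f (fderiv 𝕜 f x) (slice (f x)) :=
      hslice.symm ▸ (hf.differentiableAt hn).hasFDerivAt
    exact (hR ▸ hfx.comp _ hslice_deriv :)
  have hfix : (f ∘ slice) (f x) = f x := congrArg f hslice
  refine ⟨slice ∘ hcomp.localInverse hderiv hn, ?_, ?_, ?_⟩
  · exact hslice_smooth.contDiffAt.comp _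
      (by simpa only [hfix] using hcomp.to_localInverse hderiv hn)
  · have h := hcomp.localInverse_apply_image hderiv hn
    rw [hfix] at h
    rw [Function.comp_apply, h, hslice]
  · exact (hfix ▸ (hcomp.hasStrictFDerivAt' hderiv hn).eventually_right_inverse :)

variable {EP : Type*} [NormedAddCommGroup EP] [NormedSpace ℝ EP] {HP : Type*} [TopologicalSpace HP]
  {IP : ModelWithCorners ℝ EP HP}
  {EM : Type*} [NormedAddCommGroup EM] [NormedSpace ℝ EM] {HM : Type*} [TopologicalSpace HM]
  {IM : ModelWithCorners ℝ EM HM}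
  {EN : Type*} [NormedAddCommGroup EN] [NormedSpace ℝ EN] {HN : Type*} [TopologicalSpace HN]
  {IN : ModelWithCorners ℝ EN HN}
  {P : Type*} [TopologicalSpace P] [ChartedSpace HP P]
  {M : Type*} [TopologicalSpace M] [ChartedSpace HM M]
  {N : Type*} [TopologicalSpace N] [ChartedSpace HN N]

theorem exists_contMDiffAt_section [FiniteDimensional ℝ EM] [IP.Boundaryless]
    [IsManifold IP ∞ P] {f : P → M} {p : P} (hf : ContMDiffAt IP IM ∞ f p)
    (hsurj : Function.Surjective (mfderiv IP IM f p)) :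
    ∃ s : M → P, ContMDiffAt IM IP ∞ s (f p) ∧ s (f p) = p ∧ ∀ᶠ m in nhds (f p), f (s m) = m := by
  let F := writtenInExtChartAt IP IM p f
  have hF : ContDiffAt ℝ ∞ F (extChartAt IP p p) := by
    have h := (contMDiffAt_iff.mp hf).2
    rwa [IP.range_eq_univ, contDiffWithinAt_univ] at h
  have hFp : F (extChartAt IP p p) = extChartAt IM (f p) (f p) := by
    simp only [F, writtenInExtChartAt, Function.comp_apply, extChartAt_to_inv]
  have hFsurj : Function.Surjective (fderiv ℝ F (extChartAt IP p p)) := by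
    rw [(hf.mdifferentiableAt (by simp)).mfderiv, IP.range_eq_univ, fderivWithin_univ] at hsurj
    exact hsurj
  obtain ⟨σ, hσ, hσp, hσF⟩ := exists_contDiffAt_section hF (by simp) hFsurj
  rw [hFp] at hσ hσp hσF
  let s : M → P := (extChartAt IP p).symm ∘ σ ∘ extChartAt IM (f p)
  have hsp : s (f p) = p := by simp only [s, Function.comp_apply, hσp, extChartAt_to_inv]
  have hsymm : ContMDiffAt 𝓘(ℝ, EP) IP ∞ (extChartAt IP p).symm (extChartAt IP p p) :=
    (contMDiffOn_extChartAt_symm p).contMDiffAt (extChartAt_target_mem_nhds p)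
  have hs : ContMDiffAt IM IP ∞ s (f p) :=
    .comp_of_eq hsymm (hσ.contMDiffAt.comp _ contMDiffAt_extChartAt) hσp
  have hfs : ContinuousAt (f ∘ s) (f p) := .comp (hsp.symm ▸ hf.continuousAt) hs.continuousAt
  have hsource : ∀ᶠ m in nhds (f p), f (s m) ∈ (extChartAt IM (f p)).source :=
    hfs (extChartAt_source_mem_nhds' (by simp [hsp]))
  refine ⟨s, hs, hsp, ?_⟩
  filter_upwards [(continuousAt_extChartAt (I := IM) (f p)).eventually hσF,
    extChartAt_source_mem_nhds (I := IM) (f p), hsource] with m hσm hm hsm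
  exact (extChartAt IM (f p)).injOn hsm hm hσm

theorem surjective_mfderiv_of_section {f : P → M} {s : M → P} {p : P}
    (hf : MDifferentiableAt IP IM f p) (hs : MDifferentiableAt IM IP s (f p)) (hsp : s (f p) = p)
    (hfs : f ∘ s =ᶠ[nhds (f p)] id) : Function.Surjective (mfderiv IP IM f p) := by
  have hcomp := mfderiv_comp (f p) (hsp.symm ▸ hf : MDifferentiableAt IP IM f (s (f p))) hs
  rw [hfs.mfderiv_eq, mfderiv_id, hsp] at hcomp
  exact fun v => ⟨_, (congrArg (fun L => L v) hcomp).symm⟩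

theorem exists_homeomorph_of_isQuotientMap {X Y Z : Type*} [TopologicalSpace X]
    [TopologicalSpace Y] [TopologicalSpace Z] {f : X → Y} {g : X → Z}
    (hf : Topology.IsQuotientMap f) (hg : Topology.IsQuotientMap g)
    (hfg : ∀ x x', f x = f x' ↔ g x = g x') : ∃ Φ : Y ≃ₜ Z, ∀ x, Φ (f x) = g x := by
  let F : C(X, Y) := ⟨f, hf.continuous⟩
  let G : C(X, Z) := ⟨g, hg.continuous⟩
  have hF : Topology.IsQuotientMap F := hf
  have hG : Topology.IsQuotientMap G := hg
  have hGF : Function.FactorsThrough G F := fun _ _ => (hfg _ _).mp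
  have hFG : Function.FactorsThrough F G := fun _ _ => (hfg _ _).mpr
  have hliftF : ∀ x, hF.lift G hGF (f x) = g x := DFunLike.congr_fun (hF.lift_comp G hGF)
  have hliftG : ∀ x, hG.lift F hFG (g x) = f x := DFunLike.congr_fun (hG.lift_comp F hFG)
  exact ⟨{
    toFun := hF.lift G hGF
    invFun := hG.lift F hFG
    left_inv := hf.surjective.forall.mpr fun x => by rw [hliftF, hliftG]
    right_inv := hg.surjective.forall.mpr fun x => by rw [hliftG, hliftF]
    continuous_toFun := (hF.lift G hGF).continuous
    continuous_invFun := (hG.lift F hFG).continuous }, hliftF⟩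

theorem IsSurjSubmersion.exists_contMDiffAt_section (hP : IsSmoothManifold IP P)
    (hM : IsSmoothManifold IM M) {f : P → M} (hf : IsSurjSubmersion IP IM f) (p : P) :
    ∃ s : M → P, ContMDiffAt IM IP ∞ s (f p) ∧ s (f p) = p ∧ f ∘ s =ᶠ[nhds (f p)] id := by
  have := hM.finiteDimensional
  have := hP.boundaryless
  have := hP.isManifold
  exact QuatMoebius.exists_contMDiffAt_section hf.smooth.contMDiffAt (hf.surjective_mfderiv p)

theorem IsSurjSubmersion.isQuotientMap (hP : IsSmoothManifold IP P) (hM : IsSmoothManifold IM M)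
    {f : P → M} (hf : IsSurjSubmersion IP IM f) : Topology.IsQuotientMap f := by
  refine IsOpenMap.isQuotientMap (.of_nhds_le fun p => ?_) hf.smooth.continuous hf.surjective
  obtain ⟨s, hs, hsp, hfs⟩ := hf.exists_contMDiffAt_section hP hM p
  calc nhds (f p) = Filter.map (f ∘ s) (nhds (f p)) := by rw [Filter.map_congr hfs, Filter.map_id]
    _ = Filter.map f (Filter.map s (nhds (f p))) := Filter.map_map.symm
    _ ≤ Filter.map f (nhds p) :=
      Filter.map_mono (hs.continuousAt.tendsto.trans_eq (congrArg nhds hsp))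

theorem IsSurjSubmersion.contMDiff_of_comp (hP : IsSmoothManifold IP P)
    (hM : IsSmoothManifold IM M) {f : P → M} (hf : IsSurjSubmersion IP IM f) {h : M → N}
    (hh : ContMDiff IP IN ∞ (h ∘ f)) : ContMDiff IM IN ∞ h := by
  refine hf.surjective.forall.mpr fun p => ?_
  obtain ⟨s, hs, -, hfs⟩ := hf.exists_contMDiffAt_section hP hM p
  exact (hh.contMDiffAt.comp (f p) hs).congr_of_eventuallyEq (hfs.fun_comp h).symm

theorem IsSurjSubmersion.exists_diffeomorph (hP : IsSmoothManifold IP P)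
    (hM : IsSmoothManifold IM M) (hN : IsSmoothManifold IN N) {f : P → M} {g : P → N}
    (hf : IsSurjSubmersion IP IM f) (hg : IsSurjSubmersion IP IN g)
    (hfg : ∀ p q, f p = f q ↔ g p = g q) : ∃ D : M ≃ₘ^∞⟮IM, IN⟯ N, ∀ p, D (f p) = g p := by
  obtain ⟨Φ, hΦ⟩ := exists_homeomorph_of_isQuotientMap (hf.isQuotientMap hP hM)
    (hg.isQuotientMap hP hN) hfg
  refine ⟨⟨Φ.toEquiv, hf.contMDiff_of_comp hP hM ?_, hg.contMDiff_of_comp hP hN ?_⟩, hΦ⟩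
  · exact (funext hΦ : Φ ∘ f = g) ▸ hg.smooth
  · exact (funext fun p => Φ.symm_apply_eq.mpr (hΦ p).symm : Φ.symm ∘ g = f) ▸ hf.smooth

theorem IsSurjSubmersion.comp_diffeomorph {f : P → M} (hf : IsSurjSubmersion IP IM f)
    (D : M ≃ₘ^∞⟮IM, IN⟯ N) : IsSurjSubmersion IP IN (D ∘ f) where
  surjective := D.surjective.comp hf.surjective
  smooth := D.contMDiff.comp hf.smooth
  surjective_mfderiv p := by
    have hD : Function.Surjective (mfderiv IM IN D (f p)) :=
      surjective_mfderiv_of_section (D.mdifferentiable (by simp) _)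
        (D.symm.mdifferentiable (by simp) _) (D.symm_apply_apply _)
        (.of_eq (funext D.apply_symm_apply))
    rw [mfderiv_comp p (D.mdifferentiable (by simp) _) (hf.smooth.mdifferentiable (by simp) _)]
    exact hD.comp (hf.surjective_mfderiv p)

/-- The charted space structure on `X` transported from `M` along a homeomorphism `Φ`. Its charts
take values in the vector space `E'`, identified with the model vector space of `M` by `L`. -/
abbrev transportedChartedSpace {E' : Type*} [NormedAddCommGroup E'] [NormedSpace ℝ E'] {X : Type*}
    [TopologicalSpace X] (IM : ModelWithCorners ℝ EM HM) [IM.Boundaryless] (L : EM ≃L[ℝ] E')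
    (Φ : X ≃ₜ M) : ChartedSpace E' X where
  atlas := {e | ∃ f ∈ atlas HM M, e = (Φ.toOpenPartialHomeomorph ≫ₕ f) ≫ₕ
    (IM.toHomeomorph.trans L.toHomeomorph).toOpenPartialHomeomorph}
  chartAt x := (Φ.toOpenPartialHomeomorph ≫ₕ chartAt HM (Φ x)) ≫ₕ
    (IM.toHomeomorph.trans L.toHomeomorph).toOpenPartialHomeomorph
  mem_chart_source x := by simp
  chart_mem_atlas x := ⟨_, chart_mem_atlas _ _, rfl⟩

section Transport

variable {E' : Type*} [NormedAddCommGroup E'] [NormedSpace ℝ E'] {X : Type*} [TopologicalSpace X]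
  [IM.Boundaryless] (L : EM ≃L[ℝ] E') (Φ : X ≃ₜ M)

theorem extChartAt_transportedChartedSpace (x : X) :
    letI := transportedChartedSpace IM L Φ
    extChartAt 𝓘(ℝ, E') x = (Φ.toEquiv.toPartialEquiv.trans (extChartAt IM (Φ x))).trans
      L.toEquiv.toPartialEquiv := by
  let := transportedChartedSpace IM L Φ
  have hchart : chartAt E' x = (Φ.toOpenPartialHomeomorph ≫ₕ chartAt HM (Φ x)) ≫ₕ
    (IM.toHomeomorph.trans L.toHomeomorph).toOpenPartialHomeomorph := rfl
  refine PartialEquiv.ext (fun _ => rfl) (fun _ => rfl) ?_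
  simp [extChartAt, hchart]

variable [IsManifold IM ∞ M]

theorem isManifold_transportedChartedSpace :
    letI := transportedChartedSpace IM L Φ
    IsManifold 𝓘(ℝ, E') ∞ X := by
  let := transportedChartedSpace IM L Φ
  refine isManifold_of_contDiffOn _ _ _ ?_
  rintro _ _ ⟨f, hf, rfl⟩ ⟨g, hg, rfl⟩
  have hfg : ContDiffOn ℝ ∞ (IM ∘ (f.symm ≫ₕ g) ∘ IM.symm)
      (IM.symm ⁻¹' (f.symm ≫ₕ g).source ∩ Set.range IM) :=
    (mem_groupoid_of_pregroupoid.mp ((contDiffGroupoid ∞ IM).compatible hf hg)).1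
  refine (L.contDiff.comp_contDiffOn (hfg.comp L.symm.contDiff.contDiffOn ?_)).congr ?_
  · rintro z ⟨hz, -⟩
    simpa [IM.range_eq_univ] using hz
  · intro z _
    simp

theorem contMDiff_transportedChartedSpace :
    letI := transportedChartedSpace IM L Φ
    ContMDiff 𝓘(ℝ, E') IM ∞ Φ := by
  let := transportedChartedSpace IM L Φ
  have := isManifold_transportedChartedSpace L Φ (IM := IM)
  intro x
  have hchart : ∀ y, extChartAt 𝓘(ℝ, E') x y = L (extChartAt IM (Φ x) (Φ y)) := fun y => by
    rw [extChartAt_transportedChartedSpace L Φ (IM := IM)]; rfl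
  have hsymm : ContMDiffAt 𝓘(ℝ, EM) IM ∞ (extChartAt IM (Φ x)).symm
      (L.symm (extChartAt 𝓘(ℝ, E') x x)) := by
    rw [hchart, L.symm_apply_apply]
    exact (contMDiffOn_extChartAt_symm _).contMDiffAt (extChartAt_target_mem_nhds _)
  refine (hsymm.comp x (L.symm.contDiff.contMDiff.contMDiffAt.comp x
    (contMDiffAt_extChartAt (I := 𝓘(ℝ, E'))))).congr_of_eventuallyEq ?_
  filter_upwards [Φ.continuous.continuousAt (extChartAt_source_mem_nhds (I := IM) (Φ x))] with y hy
  simp only [Function.comp_apply, hchart, L.symm_apply_apply]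
  exact ((extChartAt IM (Φ x)).left_inv hy).symm

theorem contMDiff_symm_transportedChartedSpace :
    letI := transportedChartedSpace IM L Φ
    ContMDiff IM 𝓘(ℝ, E') ∞ Φ.symm := by
  let := transportedChartedSpace IM L Φ
  have := isManifold_transportedChartedSpace L Φ (IM := IM)
  refine Φ.surjective.forall.mpr fun x => ?_
  have hchart : ∀ m, (extChartAt 𝓘(ℝ, E') x).symm (L m) = Φ.symm ((extChartAt IM (Φ x)).symm m) :=
    fun m => by
      rw [extChartAt_transportedChartedSpace L Φ (IM := IM)]
      exact congrArg (fun m => Φ.symm ((extChartAt IM (Φ x)).symm m)) (L.symm_apply_apply m)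
  have hsymm : ContMDiffAt 𝓘(ℝ, E') 𝓘(ℝ, E') ∞ (extChartAt 𝓘(ℝ, E') x).symm
      (L (extChartAt IM (Φ x) (Φ x))) := by
    have hx : L (extChartAt IM (Φ x) (Φ x)) = extChartAt 𝓘(ℝ, E') x x := by
      rw [extChartAt_transportedChartedSpace L Φ (IM := IM)]; rfl
    rw [hx]
    exact (contMDiffOn_extChartAt_symm x).contMDiffAt (extChartAt_target_mem_nhds x)
  refine (hsymm.comp (Φ x) (L.contDiff.contMDiff.contMDiffAt.comp (Φ x)
    (contMDiffAt_extChartAt (I := IM)))).congr_of_eventuallyEq ?_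
  filter_upwards [extChartAt_source_mem_nhds (I := IM) (Φ x)] with m hm
  simp only [Function.comp_apply, hchart, (extChartAt IM (Φ x)).left_inv hm]

end Transport

theorem exists_chartedSpace_diffeomorph {E' : Type*} [NormedAddCommGroup E'] [NormedSpace ℝ E']
    [FiniteDimensional ℝ E'] {X : Type*} [TopologicalSpace X] (hM : IsSmoothManifold IM M)
    (hdim : Module.finrank ℝ EM = Module.finrank ℝ E') (Φ : M ≃ₜ X) :
    ∃ _ : ChartedSpace E' X, IsSmoothManifold 𝓘(ℝ, E') X ∧
      ∃ D : M ≃ₘ^∞⟮IM, 𝓘(ℝ, E')⟯ X, ⇑D = Φ := by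
  have := hM.finiteDimensional
  have := hM.boundaryless
  have := hM.isManifold
  have := hM.t2
  have := hM.secondCountable
  let L : EM ≃L[ℝ] E' := .ofFinrankEq hdim
  let := transportedChartedSpace IM L Φ.symm
  exact ⟨this, {
    finiteDimensional := inferInstance
    boundaryless := inferInstance
    isManifold := isManifold_transportedChartedSpace L Φ.symm
    t2 := Φ.symm.isEmbedding.t2Space
    secondCountable := Φ.symm.isEmbedding.secondCountableTopology },
    ⟨Φ.toEquiv, contMDiff_symm_transportedChartedSpace L Φ.symm,
      contMDiff_transportedChartedSpace L Φ.symm⟩, rfl⟩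

theorem IsSurjSubmersion.exists_chartedSpace {E' : Type*} [NormedAddCommGroup E']
    [NormedSpace ℝ E'] [FiniteDimensional ℝ E'] {X : Type*} [TopologicalSpace X]
    (hP : IsSmoothManifold IP P) (hM : IsSmoothManifold IM M)
    (hdim : Module.finrank ℝ EM = Module.finrank ℝ E') {f : P → M} (hf : IsSurjSubmersion IP IM f)
    {g : P → X} (hg : Topology.IsQuotientMap g) (hfg : ∀ p q, f p = f q ↔ g p = g q) :
    ∃ _ : ChartedSpace E' X, IsSmoothManifold 𝓘(ℝ, E') X ∧ IsSurjSubmersion IP 𝓘(ℝ, E') g := by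
  obtain ⟨Φ, hΦ⟩ := exists_homeomorph_of_isQuotientMap (hf.isQuotientMap hP hM) hg hfg
  obtain ⟨charts, hX, D, hD⟩ := exists_chartedSpace_diffeomorph hM hdim Φ
  have hDf : D ∘ f = g := funext fun p => (congrFun hD (f p)).trans (hΦ p)
  exact ⟨charts, hX, hDf ▸ hf.comp_diffeomorph D⟩

theorem isSurjSubmersion_of_diffeomorph_prod [Nonempty N] (Φ : (M × N) ≃ₘ^∞⟮IM.prod IN, IP⟯ P)
    {π : P → M} (hπ : ∀ m n, π (Φ (m, n)) = m) : IsSurjSubmersion IP IM π := by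
  have hsurj : Function.Surjective Φ := Φ.surjective
  have hfst : π = Prod.fst ∘ Φ.symm := funext <| hsurj.forall.mpr fun ⟨m, n⟩ => by simp [hπ]
  have hsmooth : ContMDiff IP IM ∞ π := hfst ▸ contMDiff_fst.comp Φ.symm.contMDiff
  refine ⟨fun m => ⟨Φ (m, Classical.arbitrary N), hπ _ _⟩, hsmooth, hsurj.forall.mpr ?_⟩
  rintro ⟨m, n⟩
  have hs : ContMDiff IM IP ∞ fun m => Φ (m, n) :=
    Φ.contMDiff.comp (contMDiff_id.prodMk contMDiff_const)
  exact surjective_mfderiv_of_section (hsmooth.mdifferentiable (by simp) _)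
    (hs.mdifferentiable (by simp) _) (by rw [hπ]) (.of_eq (funext fun m => hπ m n))

theorem isCompact_setOf_image_inter_nonempty {X Y G : Type*} [TopologicalSpace X] [T2Space X]
    [TopologicalSpace Y] [TopologicalSpace G] [Group G] [IsTopologicalGroup G] {act : Y → G → Y}
    (Φ : X × G ≃ₜ Y) (hact : ∀ x g h, act (Φ (x, g)) h = Φ (x, g * h)) {K : Set Y}
    (hK : IsCompact K) : IsCompact {g : G | ((act · g) '' K ∩ K).Nonempty} := by
  have hclosed : IsClosed {p : Y × Y | (Φ.symm p.1).1 = (Φ.symm p.2).1} :=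
    isClosed_eq (by fun_prop) (by fun_prop)
  convert ((hK.prod hK).inter_right hclosed).image
    (f := fun p : Y × Y => (Φ.symm p.1).2⁻¹ * (Φ.symm p.2).2) (by fun_prop) using 1
  ext g
  constructor
  · rintro ⟨_, ⟨y, hy, rfl⟩, hyg⟩
    obtain ⟨⟨x, h⟩, rfl⟩ := Φ.surjective y
    exact ⟨(Φ (x, h), act (Φ (x, h)) g), ⟨⟨hy, hyg⟩, by simp [hact]⟩, by simp [hact]⟩
  · rintro ⟨⟨y, y'⟩, ⟨⟨hy, hy'⟩, hyy'⟩, rfl⟩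
    obtain ⟨⟨x, h⟩, rfl⟩ := Φ.surjective y
    obtain ⟨⟨x', h'⟩, rfl⟩ := Φ.surjective y'
    obtain rfl : x = x' := by simpa using hyy'
    exact ⟨_, ⟨_, hy, rfl⟩, by simpa [hact] using hy'⟩

theorem IsPrincipalFiberBundle.of_diffeomorph {EG : Type*} [NormedAddCommGroup EG]
    [NormedSpace ℝ EG] {HG : Type*} [TopologicalSpace HG] {IG : ModelWithCorners ℝ EG HG}
    {G : Type*} [TopologicalSpace G] [ChartedSpace HG G] [Group G] [LieGroup IG ∞ G]
    (hP : IsSmoothManifold IP P) (hM : IsSmoothManifold IM M) (hG : IsSmoothManifold IG G)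
    {act : P → G → P} {π : P → M} (Φ : (M × G) ≃ₘ^∞⟮IM.prod IG, IP⟯ P)
    (hπ : ∀ m g, π (Φ (m, g)) = m) (hact : ∀ m g h, act (Φ (m, g)) h = Φ (m, g * h)) :
    IsPrincipalFiberBundle IP IM IG act π := by
  have := hM.t2
  have : IsTopologicalGroup G := topologicalGroup_of_lieGroup IG ∞
  have hinj : Function.Injective Φ := Φ.injective
  have hsurj : Function.Surjective Φ := Φ.surjective
  exact
  { total := hP
    base := hM
    group := hG
    lieGroup := inferInstance
    submersion := isSurjSubmersion_of_diffeomorph_prod Φ hπ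
    act_one := hsurj.forall.mpr fun ⟨m, g⟩ => by rw [hact, mul_one]
    act_mul := hsurj.forall.mpr fun ⟨m, g⟩ h k => by rw [hact, hact, hact, mul_assoc]
    smooth_act := by
      have hact' : ∀ p g, act p g = Φ ((Φ.symm p).1, (Φ.symm p).2 * g) :=
        hsurj.forall.mpr fun ⟨m, g⟩ h => by simp [hact]
      have hsymm := Φ.symm.contMDiff.comp (contMDiff_fst (I := IP) (J := IG) (M := P) (N := G))
      exact (Φ.contMDiff.comp (.prodMk (contMDiff_fst.comp hsymm)
        ((contMDiff_snd.comp hsymm).mul contMDiff_snd))).congr fun x => hact' x.1 x.2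
    free := hsurj.forall.mpr fun ⟨m, g⟩ h hh => by simpa [hact] using hh
    proper := fun _ => isCompact_setOf_image_inter_nonempty Φ.toHomeomorph hact
    orbit_eq_fiber := hsurj.forall.mpr fun ⟨m, g⟩ => Set.ext <| hsurj.forall.mpr fun ⟨m', g'⟩ => by
      simp only [Set.mem_range, hact, Set.mem_preimage, Set.mem_singleton_iff, hπ, hinj.eq_iff,
        Prod.mk.injEq, exists_and_left]
      exact ⟨fun h => h.1.symm, fun h => ⟨h.symm, g⁻¹ * g', mul_inv_cancel_left g g'⟩⟩
    locallyTrivial := fun m => ⟨Set.univ, isOpen_univ, trivial, Φ.toPartialDiffeomorph,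
      Set.univ_prod_univ.symm, rfl, fun x _ g => ⟨hπ x g, fun h => (hact x g h).symm⟩⟩ }

end Submersion

/-! ### The global trivialization of the right translations -/

instance (A : Type*) [NormedRing A] [NormedAlgebra ℝ A] : ContMDiffMul 𝓘(ℝ, A) ∞ A where
  contMDiff_mul := by
    rw [← modelWithCornersSelf_prod, chartedSpaceSelf_prod]
    exact contDiff_mul.contMDiff

instance : LieGroup (𝓡 3) ∞ Sp1 where
  contMDiff_mul := by
    have hfst : ContMDiff ((𝓡 3).prod (𝓡 3)) 𝓘(ℝ, ℍ[ℝ]) ∞ fun p : Sp1 × Sp1 => (p.1 : ℍ[ℝ]) :=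
      contMDiff_coe_sphere.comp contMDiff_fst
    have hsnd : ContMDiff ((𝓡 3).prod (𝓡 3)) 𝓘(ℝ, ℍ[ℝ]) ∞ fun p : Sp1 × Sp1 => (p.2 : ℍ[ℝ]) :=
      contMDiff_coe_sphere.comp contMDiff_snd
    exact (hfst.mul hsnd).codRestrict_sphere fun p => (p.1 * p.2).2
  contMDiff_inv := by
    have hstar : ContMDiff (𝓡 3) 𝓘(ℝ, ℍ[ℝ]) ∞ fun u : Sp1 => star (u : ℍ[ℝ]) :=
      contDiff_star_quaternion.contMDiff.comp contMDiff_coe_sphere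
    simp only [star_coe_Sp1] at hstar
    exact hstar.codRestrict_sphere fun u => (u⁻¹).2

theorem isSmoothManifold_Sp1 : IsSmoothManifold (𝓡 3) Sp1 where
  finiteDimensional := inferInstance
  boundaryless := inferInstance
  isManifold := inferInstance
  t2 := inferInstance
  secondCountable := inferInstance

theorem isSmoothManifold_Sp11 : IsSmoothManifold sp11ModelWithCorners Sp11 where
  finiteDimensional := inferInstance
  boundaryless := inferInstance
  isManifold := inferInstance
  t2 := sp11Homeomorph.isEmbedding.t2Space
  secondCountable := sp11Homeomorph.isEmbedding.secondCountableTopology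

/-- The product `ℍ × Sp(1)`, which serves as a global parameter space of `Sp(1,1) / Sp(1)I₂` and of
`𝓜(𝔹)`. -/
abbrev BaseParam : Type := ℍ[ℝ] × Sp1

/-- The model of `ℍ × Sp(1)`. -/
abbrev baseModelWithCorners : ModelWithCorners ℝ (ℍ[ℝ] × EuclideanSpace ℝ (Fin 3))
    (ModelProd ℍ[ℝ] (EuclideanSpace ℝ (Fin 3))) :=
  𝓘(ℝ, ℍ[ℝ]).prod (𝓡 3)

theorem isSmoothManifold_BaseParam : IsSmoothManifold baseModelWithCorners BaseParam where
  finiteDimensional := inferInstance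
  boundaryless := inferInstance
  isManifold := inferInstance
  t2 := inferInstance
  secondCountable := inferInstance

theorem finrank_baseModel : Module.finrank ℝ (ℍ[ℝ] × EuclideanSpace ℝ (Fin 3)) = 7 := by
  rw [Module.finrank_prod, Quaternion.finrank_eq_four, finrank_euclideanSpace_fin]

/-- The diffeomorphism `((x, y), g) ↦ (x g, g, y g)`, which turns right multiplication of `g` into
simultaneous right multiplication of the three parameters of a matrix in `Sp(1,1)`. -/
def paramShear : (BaseParam × Sp1) ≃ₘ^∞⟮baseModelWithCorners.prod (𝓡 3), sp11ModelWithCorners⟯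
    Sp11Param where
  toFun p := (p.1.1 * p.2, p.2, p.1.2 * p.2)
  invFun x := ((x.1 * (x.2.1⁻¹ : Sp1), x.2.2 * x.2.1⁻¹), x.2.1)
  left_inv p := by simp [ne_zero_of_mem_unit_sphere p.2]
  right_inv x := by simp [ne_zero_of_mem_unit_sphere x.2.1]
  contMDiff_toFun := by
    have hx : ContMDiff (baseModelWithCorners.prod (𝓡 3)) 𝓘(ℝ, ℍ[ℝ]) ∞
        fun p : BaseParam × Sp1 => p.1.1 := contMDiff_fst.comp contMDiff_fst
    have hy : ContMDiff (baseModelWithCorners.prod (𝓡 3)) (𝓡 3) ∞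
        fun p : BaseParam × Sp1 => p.1.2 := contMDiff_snd.comp contMDiff_fst
    have hg : ContMDiff (baseModelWithCorners.prod (𝓡 3)) (𝓡 3) ∞
        fun p : BaseParam × Sp1 => p.2 := contMDiff_snd
    exact (hx.mul (contMDiff_coe_sphere.comp hg)).prodMk (hg.prodMk (hy.mul hg))
  contMDiff_invFun := by
    have hb : ContMDiff sp11ModelWithCorners 𝓘(ℝ, ℍ[ℝ]) ∞ fun x : Sp11Param => x.1 :=
      contMDiff_fst
    have hu : ContMDiff sp11ModelWithCorners (𝓡 3) ∞ fun x : Sp11Param => x.2.1 :=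
      contMDiff_fst.comp contMDiff_snd
    have hv : ContMDiff sp11ModelWithCorners (𝓡 3) ∞ fun x : Sp11Param => x.2.2 :=
      contMDiff_snd.comp contMDiff_snd
    exact ((hb.mul (contMDiff_coe_sphere.comp hu.inv)).prodMk (hv.mul hu.inv)).prodMk hu

theorem sp11ToParam_rightTranslation (A : Sp11) (g : Sp1) :
    sp11ToParam (rightTranslation A g) =
      ((sp11ToParam A).1 * g, (sp11ToParam A).2.1 * g, (sp11ToParam A).2.2 * g) := by
  refine Prod.ext ?_ (Prod.ext (Subtype.ext ?_) (Subtype.ext ?_)) <;>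
    simp [sp11ToParam, rightTranslation_apply]

/-- The diffeomorphism taking `((x, y), g)` to the matrix with parameters `(x g, g, y g)`. It is a
global trivialization of `Sp(1,1)` as a principal `Sp(1)`-bundle over `ℍ × Sp(1)`. -/
def trivialization :
    (BaseParam × Sp1) ≃ₘ^∞⟮baseModelWithCorners.prod (𝓡 3), sp11ModelWithCorners⟯ Sp11 :=
  paramShear.trans ⟨sp11Homeomorph.symm.toEquiv, contMDiff_sp11Homeomorph_symm,
    contMDiff_sp11Homeomorph⟩

theorem trivialization_mul (z : BaseParam) (g h : Sp1) :
    trivialization (z, g * h) = rightTranslation (trivialization (z, g)) h := by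
  refine sp11Homeomorph.injective ?_
  change sp11ToParam (sp11OfParam _) = sp11ToParam (rightTranslation (sp11OfParam _) h)
  rw [sp11ToParam_rightTranslation, sp11ToParam_ofParam, sp11ToParam_ofParam]
  simp [paramShear, mul_assoc]

/-- The projection of `Sp(1,1)` onto its orbit space `ℍ × Sp(1)`. -/
def baseProj (A : Sp11) : BaseParam := (trivialization.symm A).1

theorem baseProj_trivialization (z : BaseParam) (g : Sp1) :
    baseProj (trivialization (z, g)) = z := by
  rw [baseProj, Diffeomorph.symm_apply_apply]

theorem isPrincipalFiberBundle_baseProj : IsPrincipalFiberBundle sp11ModelWithCorners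
    baseModelWithCorners (𝓡 3) rightTranslation baseProj :=
  .of_diffeomorph isSmoothManifold_Sp11 isSmoothManifold_BaseParam isSmoothManifold_Sp1
    trivialization baseProj_trivialization fun z g h => (trivialization_mul z g h).symm

theorem coe_trivialization (z : BaseParam) (g : Sp1) :
    (trivialization (z, g)).1 = !![√(1 + ‖z.1‖ ^ 2) • (g : ℍ[ℝ]), star z.1 * z.2 * g;
      z.1 * g, √(1 + ‖z.1‖ ^ 2) • (z.2 * g : ℍ[ℝ])] := by
  change (sp11OfParam (z.1 * g, g, z.2 * g)).1 = _
  have hg : (g : ℍ[ℝ]) ≠ 0 := ne_zero_of_mem_unit_sphere g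
  simp [sp11OfParam, star_coe_Sp1, hg, mul_assoc]

theorem moebiusProj_rightTranslation (A : Sp11) (u : Sp1) :
    moebiusProj (rightTranslation A u) = moebiusProj A := by
  refine Subtype.ext ?_
  change regularMoebius (A * scalarHom u)⁻¹ = regularMoebius A⁻¹
  rw [mul_inv_rev, ← map_inv, regularMoebius_scalarHom_mul]

theorem coeff_moebiusProj_trivialization_zero (z : BaseParam) (g : Sp1) :
    coeff (moebiusProj (trivialization (z, g))).1 0 = -((√(1 + ‖z.1‖ ^ 2))⁻¹ • z.1) := by
  have hg : (g : ℍ[ℝ]) ≠ 0 := ne_zero_of_mem_unit_sphere g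
  have hz : (z.2 : ℍ[ℝ]) ≠ 0 := ne_zero_of_mem_unit_sphere z.2
  refine (coeff_regularMoebius_zero _).trans ?_
  simp [Sp11.inv_entries, coe_trivialization, star_coe_Sp1, smul_inv₀, mul_assoc, hg, hz]

theorem coeff_moebiusProj_trivialization_one (z : BaseParam) (g : Sp1) :
    coeff (moebiusProj (trivialization (z, g))).1 1 = (1 + ‖z.1‖ ^ 2)⁻¹ • (z.2 : ℍ[ℝ]) := by
  have hg : (g : ℍ[ℝ]) ≠ 0 := ne_zero_of_mem_unit_sphere g
  have hs : √(1 + ‖z.1‖ ^ 2) * √(1 + ‖z.1‖ ^ 2) = 1 + ‖z.1‖ ^ 2 :=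
    Real.mul_self_sqrt (by positivity)
  refine (coeff_regularMoebius_one _).trans ?_
  simp [Sp11.inv_entries, coe_trivialization, star_coe_Sp1, smul_inv₀, mul_assoc, hg, smul_smul,
    ← mul_inv, hs]

theorem baseProj_eq_iff_exists_rightTranslation (A B : Sp11) :
    baseProj A = baseProj B ↔ ∃ u, rightTranslation A u = B := by
  change _ ↔ B ∈ Set.range (rightTranslation A)
  rw [isPrincipalFiberBundle_baseProj.orbit_eq_fiber]
  exact eq_comm

theorem baseProj_eq_iff_mk_eq (A B : Sp11) :
    baseProj A = baseProj B ↔ (A : Sp11 ⧸ scalarSubgroup) = B := by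
  rw [baseProj_eq_iff_exists_rightTranslation, QuotientGroup.eq]
  exact exists_congr fun u => eq_inv_mul_iff_mul_eq.symm

theorem baseProj_eq_iff_moebiusProj_eq (A B : Sp11) :
    baseProj A = baseProj B ↔ moebiusProj A = moebiusProj B := by
  constructor
  · intro h
    obtain ⟨u, rfl⟩ := (baseProj_eq_iff_exists_rightTranslation A B).mp h
    exact (moebiusProj_rightTranslation A u).symm
  · intro h
    have hsurj : Function.Surjective trivialization := trivialization.surjective
    obtain ⟨⟨z, g⟩, rfl⟩ := hsurj A
    obtain ⟨⟨z', g'⟩, rfl⟩ := hsurj B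
    have hzero := congrArg (fun f : MoebiusB => coeff f.1 0) h
    have hone := congrArg (fun f : MoebiusB => coeff f.1 1) h
    simp only [coeff_moebiusProj_trivialization_zero, coeff_moebiusProj_trivialization_one,
      neg_inj] at hzero hone
    have hfst : z.1 = z'.1 := OpenPartialHomeomorph.univUnitBall.injOn (Set.mem_univ _)
      (Set.mem_univ _) (by simpa only [OpenPartialHomeomorph.univUnitBall_apply] using hzero)
    have hsnd : z.2 = z'.2 := by
      rw [hfst] at hone
      exact Subtype.ext (smul_right_injective _ (by positivity) hone)
    rw [baseProj_trivialization, baseProj_trivialization, Prod.ext hfst hsnd]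

/-! ### The manifold structure of `𝓜(𝔹)` -/

theorem surjective_moebiusProj : Function.Surjective moebiusProj := by
  rintro ⟨_, A, rfl⟩
  exact ⟨A⁻¹, Subtype.ext (congrArg regularMoebius (inv_inv A))⟩

theorem exists_chartedSpace_of_isQuotientMap {X : Type*} [TopologicalSpace X] {g : Sp11 → X}
    (hg : Topology.IsQuotientMap g) (hfg : ∀ A B, baseProj A = baseProj B ↔ g A = g B) :
    ∃ _ : ChartedSpace (EuclideanSpace ℝ (Fin 7)) X,
      IsSmoothManifold (𝓡 7) X ∧ IsSurjSubmersion sp11ModelWithCorners (𝓡 7) g :=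
  isPrincipalFiberBundle_baseProj.submersion.exists_chartedSpace isSmoothManifold_Sp11
    isSmoothManifold_BaseParam (finrank_baseModel.trans finrank_euclideanSpace_fin.symm) hg hfg

theorem isQuotientStructure_iff {S : SmoothStructure 7 MoebiusB} :
    IsQuotientStructure S ↔
      letI := S.top
      letI := S.charts
      IsSurjSubmersion sp11ModelWithCorners (𝓡 7) moebiusProj := by
  let := S.top
  let := S.charts
  constructor
  · rintro ⟨_, -, hmk, e, he⟩
    exact (funext he : e ∘ _ = moebiusProj) ▸ hmk.comp_diffeomorph e
  · intro hπ
    obtain ⟨charts, hquot, hmk⟩ :=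
      exists_chartedSpace_of_isQuotientMap (QuotientGroup.isQuotientMap_mk _) baseProj_eq_iff_mk_eq
    exact ⟨charts, hquot, hmk, hmk.exists_diffeomorph isSmoothManifold_Sp11 hquot
      S.isSmoothManifold hπ fun A B =>
        (baseProj_eq_iff_mk_eq A B).symm.trans (baseProj_eq_iff_moebiusProj_eq A B)⟩

theorem exists_isQuotientStructure : ∃ S : SmoothStructure 7 MoebiusB, IsQuotientStructure S := by
  let top : TopologicalSpace MoebiusB := .coinduced moebiusProj inferInstance
  obtain ⟨charts, hM, hπ⟩ := exists_chartedSpace_of_isQuotientMap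
    ⟨⟨rfl⟩, surjective_moebiusProj⟩ baseProj_eq_iff_moebiusProj_eq
  exact ⟨⟨top, charts, hM⟩, isQuotientStructure_iff.mpr hπ⟩

theorem IsQuotientStructure.same {S T : SmoothStructure 7 MoebiusB} (hS : IsQuotientStructure S)
    (hT : IsQuotientStructure T) : S.Same T := by
  have smooth_id {S T : SmoothStructure 7 MoebiusB} (hS : IsQuotientStructure S)
      (hT : IsQuotientStructure T) :
      @ContMDiff ℝ _ _ _ _ _ _ (𝓡 7) MoebiusB S.top S.charts _ _ _ _ _ (𝓡 7) MoebiusB T.top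
        T.charts ∞ id := by
    obtain ⟨-, hsmooth, -⟩ := isQuotientStructure_iff.mp hT
    exact @IsSurjSubmersion.contMDiff_of_comp _ _ _ _ _ _ _ _ _ _ _ _ _ _ _ _ _ _ Sp11 _ _
      MoebiusB S.top S.charts MoebiusB T.top T.charts isSmoothManifold_Sp11 S.isSmoothManifold _
      (isQuotientStructure_iff.mp hS) _ hsmooth
  exact ⟨smooth_id hS hT, smooth_id hT hS⟩

theorem IsQuotientStructure.isMoebiusBundle {S : SmoothStructure 7 MoebiusB}
    (hS : IsQuotientStructure S) : IsMoebiusBundle S := by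
  let := S.top
  let := S.charts
  obtain ⟨D, hD⟩ := isPrincipalFiberBundle_baseProj.submersion.exists_diffeomorph
    isSmoothManifold_Sp11 isSmoothManifold_BaseParam S.isSmoothManifold
    (isQuotientStructure_iff.mp hS) baseProj_eq_iff_moebiusProj_eq
  refine .of_diffeomorph isSmoothManifold_Sp11 S.isSmoothManifold isSmoothManifold_Sp1
    ((D.symm.prodCongr (Diffeomorph.refl (𝓡 3) Sp1 ∞)).trans trivialization) ?_ ?_
  · intro f g
    change moebiusProj (trivialization (D.symm f, g)) = f
    rw [← hD, baseProj_trivialization, D.apply_symm_apply]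
  · exact fun f g h => (trivialization_mul (D.symm f) g h).symm

end QuatMoebius

end

theorem mainTheorem6 :
    (∀ (A : QuatMoebius.Sp11) (q : QuatMoebius.UnitBall),
      QuatMoebius.regularMoebius A q ∈ Metric.ball (0 : ℍ[ℝ]) 1) ∧
    (∃ S : QuatMoebius.SmoothStructure 7 QuatMoebius.MoebiusB,
      QuatMoebius.IsQuotientStructure S) ∧
    (∀ S T : QuatMoebius.SmoothStructure 7 QuatMoebius.MoebiusB,
      QuatMoebius.IsQuotientStructure S → QuatMoebius.IsQuotientStructure T → S.Same T) ∧
    (∀ S : QuatMoebius.SmoothStructure 7 QuatMoebius.MoebiusB,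
      QuatMoebius.IsQuotientStructure S → QuatMoebius.IsMoebiusBundle S) :=
  ⟨QuatMoebius.regularMoebius_mem_ball, QuatMoebius.exists_isQuotientStructure,
    fun _ _ hS hT => hS.same hT, fun _ hS => hS.isMoebiusBundle⟩
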